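/- \textbf{Setting.} Let $\Omega\subset\mathbb R^2$ be a bounded open set and let $\mathbf g:\Omega\to\mathbb R^{2\times2}$ be a bounded measurable field of symmetric, uniformly positive definite matrices (for example $\mathbf g\in[W^{1,\infty}(\Omega)]^{2\times 2}$). Let $\Sigma\subset\Omega$ be a (possibly empty) crease, and let $\mu>0$, $\lambda\ge0$, $\gamma>0$, $\theta>0$, and integers $k\ge2$, $\ell\ge0$. $|\cdot|$ is the Euclidean (Frobenius) norm of vectors, matrices and tensors, and $L^p$ norms of such fields are those of $|\cdot|$. A conforming mesh $\mathcal T_h$ of $\Omega$ is a finite set of elements covering $\overline\Omega$ such that two different elements are disjoint or meet in a common vertex or a common edge; each element is $T=\psi_T(\hat T)$, where $\hat T$ is a reference triangle (resp. square) and $\psi_T:\hat T\to T$ is a diffeomorphism with components in $\mathbb P_k(\hat T)$ (resp. $\mathbb Q_k(\hat T)$). $h_T$ and $h_e$ denote the diameters of the element $T$ and of the edge $e$. A family of meshes is shape-regular if $|D\psi_T|\lesssim h_T$ and $|(D\psi_T)^{-1}|\lesssim h_T^{-1}$ on $\hat T$, and quasi-uniform if $h_T\lesssim h_{T'}$ for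 all elements $T,T'$ of the same mesh, with constants uniform over the family. $\mathcal E_h^0$ is the set of interior edges. A mesh resolves $\Sigma$ if $\Sigma$ is, up to endpoints of edges, a union of interior edges; $\mathcal E_h^\Sigma$ is the set of interior edges along $\Sigma$. Each interior edge $e$, shared by $T^-$ and $T^+$, has a fixed unit normal $\mathbf n_e$ pointing from $T^-$ to $T^+$. With $w^\pm$ the traces on $e$ from $T^\pm$, set $[w]=w^--w^+$ and $\{w\}=\frac12(w^++w^-)$. Define $$S_h^k=\{v\in C^0(\overline\Omega): v|_T\circ\psi_T\in\mathbb P_k\ (\text{resp. }\mathbb Q_k)\ \forall T\},\qquad V_h^\ell=\{v\in L^2(\Omega): v|_T\circ\psi_T\in\mathbb P_\ell\ (\text{resp. }\mathbb Q_\ell)\ \forall T\}.$$ For $v\in S_h^k$ let $D_h^2v$ be the elementwise Hessian, and for $e\in\mathcal E_h^0\setminus\mathcal E_h^\Sigma$ let $r_e([\nabla v])\in[V_h^\ell]^{2\times2}$ be the field supported on $\omega_e=T^-\cup T^+$ with $\int_{\omega_e}r_e([\nabla v]):\boldsymbol\tau=\int_e\{\boldsymbol\tau\}\mathbf n_e\cdot[\nabla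 v]$ for all $\boldsymbol\tau\in[V_h^\ell]^{2\times2}$. The discrete Hessian is $H_h(v)=D_h^2v-\sum_{e\in\mathcal E_h^0\setminus\mathcal E_h^\Sigma}r_e([\nabla v])$. Put $$J_h(v)=\sum_{e\in\mathcal E_h^0\setminus\mathcal E_h^\Sigma}h_e^{-1}\int_e|[\nabla v]|^2,\qquad |v|_{H_h^2}^2=\|D_h^2v\|_{L^2(\Omega)}^2+J_h(v);$$ for $\mathbf y_h=(y_1,y_2,y_3)\in[S_h^k]^3$ apply $H_h$ and $\nabla$ componentwise and sum $J_h$ and $|\cdot|_{H^2_h}^2$ over the components. The energies are $$E_h^S(\mathbf y_h)=\tfrac18\int_\Omega\Big(2\mu\big|\mathbf g^{-1/2}(\nabla\mathbf y_h^T\nabla\mathbf y_h-\mathbf g)\mathbf g^{-1/2}\big|^2+\lambda\,\mathrm{tr}\big(\mathbf g^{-1/2}(\nabla\mathbf y_h^T\nabla\mathbf y_h-\mathbf g)\mathbf g^{-1/2}\big)^2\Big),$$ $$E_h^B(\mathbf y_h)=\tfrac1{24}\sum_{m=1}^3\int_\Omega\Big(2\mu\big|\mathbf g^{-1/2}H_h(y_m)\mathbf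 g^{-1/2}\big|^2+\tfrac{2\mu\lambda}{2\mu+\lambda}\mathrm{tr}\big(\mathbf g^{-1/2}H_h(y_m)\mathbf g^{-1/2}\big)^2\Big)+\tfrac\gamma2J_h(\mathbf y_h),$$ and $E_h=E_h^S+\theta^2E_h^B$. \textbf{Theorem (partial coercivity of $E_h$).} (a) There is a constant $C_1>0$ depending only on $\mu$ such that, for every $\Omega$, $\mathbf g$, $\lambda$, $k$, every conforming mesh of $\Omega$ and every $\mathbf y_h\in[S_h^k]^3$, $$\|\nabla\mathbf y_h\|_{L^2(\Omega)}^2\le C_1\Big(|\Omega|^{1/2}\|\mathbf g\|_{L^\infty(\Omega)}E_h^S(\mathbf y_h)^{1/2}+\|\mathbf g\|_{L^1(\Omega)}\Big).$$ (b) Let $\Omega,\mathbf g,\Sigma,\mu,\lambda,k,\ell$ and a shape-regular, quasi-uniform family $\{\mathcal T_h\}$ of conforming meshes of $\Omega$ resolving $\Sigma$ be given. There is a function $\gamma\mapsto C_2(\gamma)>0$ on $(0,\infty)$ with $C_2(\gamma)\to\infty$ as $\gamma\to0^+$ such that, for all $\gamma>0$, all meshes of the family and all $\mathbf y_h\in[S_h^k]^3$,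 $$|\mathbf y_h|_{H_h^2}^2\le C_2(\gamma)\,\|\mathbf g\|_{L^\infty(\Omega)}E_h^B(\mathbf y_h).$$ (c) For all $\Omega$ and $\mathbf g$ there is $C\ge0$, depending only on $\Omega$ and $\mathbf g$, such that for all $\Sigma,\mu,\lambda,\gamma,k,\ell$ and every family of meshes as in (b) there is $K>0$ such that, for all $\theta>0$, all meshes of the family and all $\mathbf y_h\in[S_h^k]^3$, $$\|\nabla\mathbf y_h\|_{L^2(\Omega)}^4+\theta^2|\mathbf y_h|_{H_h^2}^2\le K\big(E_h(\mathbf y_h)+C\big).$$ -/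

import Mathlib

open MeasureTheory Filter Topology

noncomputable section

namespace PrestrainedPlate

/-- The plane `ℝ²` with its Euclidean norm. -/
abbrev Plane := EuclideanSpace ℝ (Fin 2)

/-! ## Matrices -/

/-- Squared Frobenius norm `|A|² = A : A`. -/
def frobSq {m n : ℕ} (A : Matrix (Fin m) (Fin n) ℝ) : ℝ := ∑ i, ∑ j, A i j ^ 2

/-- Frobenius norm `|A|`. -/
def frobNorm {m n : ℕ} (A : Matrix (Fin m) (Fin n) ℝ) : ℝ := √(frobSq A)

/-- Frobenius product `A : B`. -/
def frobInner {m n : ℕ} (A B : Matrix (Fin m) (Fin n) ℝ) : ℝ := ∑ i, ∑ j, A i j * B i j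

/-- `G^{-1/2}` for a symmetric positive definite matrix `G`: the inverse of its square root. -/
def invSqrt (G : Matrix (Fin 2) (Fin 2) ℝ) : Matrix (Fin 2) (Fin 2) ℝ := (cfc Real.sqrt G)⁻¹

/-! ## Derivatives and traces -/

/-- `∇v = (∂₁v, ∂₂v)`. A finite element function is smooth inside every element, so for it this
is the elementwise gradient; the skeleton of the mesh, where `v` need not be differentiable, is a
null set. -/
def grad (v : Plane → ℝ) (x : Plane) : Fin 2 → ℝ :=
  fun j => fderiv ℝ v x (EuclideanSpace.single j 1)

/-- `D²v = (∂ⱼ∂ₖv)ⱼₖ`; for a finite element function this is the broken (elementwise) Hessian,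
since the derivatives at a point inside an element only see the function on that element. -/
def brokenHessian (v : Plane → ℝ) (x : Plane) : Matrix (Fin 2) (Fin 2) ℝ :=
  Matrix.of fun j k => grad (fun z => grad v z k) x j

/-- `(∇y)ᵢⱼ = ∂ⱼyᵢ`. -/
def jac (y : Fin 3 → Plane → ℝ) (x : Plane) : Matrix (Fin 3) (Fin 2) ℝ :=
  Matrix.of fun i j => grad (y i) x j

/-- Trace at `x` of `w` from inside the set `U`: the limit of `w z` as `z → x`, `z ∈ U`. -/
def traceFrom (U : Set Plane) (w : Plane → ℝ) (x : Plane) : ℝ := limUnder (𝓝[U] x) w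

/-! ## Reference cells -/

/-- The two kinds of reference cells. -/
inductive RefCell where
  | triangle
  | quadrilateral

namespace RefCell

/-- Number of vertices, which is also the number of edges. -/
def numVertices : RefCell → ℕ
  | triangle => 3
  | quadrilateral => 4

/-- The vertices of the unit triangle and of the unit square, counterclockwise. -/
def vertex : (s : RefCell) → Fin s.numVertices → Plane
  | triangle => ![!₂[0, 0], !₂[1, 0], !₂[0, 1]]
  | quadrilateral => ![!₂[0, 0], !₂[1, 0], !₂[1, 1], !₂[0, 1]]

/-- The closed reference cell. -/
def cell (s : RefCell) : Set Plane := convexHull ℝ (Set.range s.vertex)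

/-- The `a`-th closed edge, from vertex `a` to its counterclockwise successor. -/
def edge (s : RefCell) (a : Fin s.numVertices) : Set Plane :=
  segment ℝ (s.vertex a) (s.vertex (finRotate _ a))

/-- The `a`-th edge without its endpoints. -/
def openEdge (s : RefCell) (a : Fin s.numVertices) : Set Plane :=
  openSegment ℝ (s.vertex a) (s.vertex (finRotate _ a))

/-- An outward normal vector to the `a`-th edge: the tangent turned by `-π/2`. -/
def normal (s : RefCell) (a : Fin s.numVertices) : Fin 2 → ℝ :=
  ![s.vertex (finRotate _ a) 1 - s.vertex a 1, -(s.vertex (finRotate _ a) 0 - s.vertex a 0)]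

/-- `ℙ_r` on the triangle, `ℚ_r` on the quadrilateral. -/
def polySpace (s : RefCell) (r : ℕ) : Submodule ℝ (MvPolynomial (Fin 2) ℝ) :=
  match s with
  | triangle => MvPolynomial.restrictTotalDegree (Fin 2) ℝ r
  | quadrilateral => MvPolynomial.restrictDegree (Fin 2) ℝ r

end RefCell

/-- Value of a polynomial in two variables at a point of the plane. -/
def polyEval (p : MvPolynomial (Fin 2) ℝ) (x : Plane) : ℝ := MvPolynomial.eval (fun i => x i) p

/-! ## Isoparametric elements -/

/-- An isoparametric element of degree `k`: a reference cell together with a diffeomorphism `ψ` of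
the closed cell onto its image, with components in `ℙ_k` (resp. `ℚ_k`). -/
structure IsoElement (k : ℕ) where
  ref : RefCell
  ψ : Fin 2 → MvPolynomial (Fin 2) ℝ
  ψ_mem : ∀ i, ψ i ∈ ref.polySpace k
  injOn : Set.InjOn (fun z : Plane => (!₂[polyEval (ψ 0) z, polyEval (ψ 1) z] : Plane)) ref.cell
  det_ne_zero : ∀ z ∈ ref.cell,
    (Matrix.of fun i j => polyEval (MvPolynomial.pderiv j (ψ i)) z).det ≠ 0

namespace IsoElement

variable {k : ℕ}

/-- The map `ψ_T`. -/
def map (T : IsoElement k) (z : Plane) : Plane := !₂[polyEval (T.ψ 0) z, polyEval (T.ψ 1) z]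

/-- The inverse of `ψ_T` on the element. -/
def inv (T : IsoElement k) : Plane → Plane := Function.invFunOn T.map T.ref.cell

/-- The Jacobian matrix `Dψ_T`. -/
def jacobian (T : IsoElement k) (z : Plane) : Matrix (Fin 2) (Fin 2) ℝ :=
  Matrix.of fun i j => polyEval (MvPolynomial.pderiv j (T.ψ i)) z

/-- The closed element `T`. -/
def carrier (T : IsoElement k) : Set Plane := T.map '' T.ref.cell

/-- The interior of the element. -/
def openCell (T : IsoElement k) : Set Plane := T.map '' interior T.ref.cell

/-- The `a`-th vertex of `T`. -/
def vertex (T : IsoElement k) (a : Fin T.ref.numVertices) : Plane := T.map (T.ref.vertex a)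

/-- The `a`-th (closed, possibly curved) edge of `T`. -/
def edge (T : IsoElement k) (a : Fin T.ref.numVertices) : Set Plane := T.map '' T.ref.edge a

/-- The `a`-th edge of `T` without its endpoints. -/
def openEdge (T : IsoElement k) (a : Fin T.ref.numVertices) : Set Plane :=
  T.map '' T.ref.openEdge a

/-- The diameter `h_T`. -/
def diam (T : IsoElement k) : ℝ := Metric.diam T.carrier

/-- The outward unit normal to `T` at a point `x` of its `a`-th edge: the normalization of
`(Dψ_T)^{-T} n̂`, where `n̂` is the outward normal to the edge of the reference cell. -/
def unitNormal (T : IsoElement k) (a : Fin T.ref.numVertices) (x : Plane) : Fin 2 → ℝ :=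
  let w := ((T.jacobian (T.inv x))⁻¹).transpose.mulVec (T.ref.normal a)
  (√(w ⬝ᵥ w))⁻¹ • w

end IsoElement

/-! ## Meshes -/

/-- A conforming subdivision of `Ω` into finitely many isoparametric elements of degree `k`: two
different elements are disjoint, or meet in a common vertex or in a common edge. -/
structure IsoMesh (k : ℕ) (Ω : Set Plane) where
  N : ℕ
  elem : Fin N → IsoElement k
  cover : ⋃ i, (elem i).carrier = closure Ω
  conforming : ∀ i j, i ≠ j →
    (elem i).carrier ∩ (elem j).carrier = ∅ ∨
    (∃ a b, (elem i).carrier ∩ (elem j).carrier = {(elem i).vertex a} ∧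
      (elem i).vertex a = (elem j).vertex b) ∨
    (∃ a b, (elem i).carrier ∩ (elem j).carrier = (elem i).edge a ∧
      (elem i).edge a = (elem j).edge b)

namespace IsoMesh

variable {k : ℕ} {Ω : Set Plane}

/-- The index `⟨i, j, a⟩` stands for the `a`-th edge of the `i`-th element, the `j`-th element
being the candidate for the element on the other side. -/
abbrev EdgeIndex (M : IsoMesh k Ω) :=
  Σ i : Fin M.N, Fin M.N × Fin (M.elem i).ref.numVertices

/-- The element `T⁻` of an edge; the fixed unit normal `n_e` points out of it. -/
def minus (M : IsoMesh k Ω) (e : M.EdgeIndex) : IsoElement k := M.elem e.1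

/-- The element `T⁺` of an edge; the fixed unit normal `n_e` points into it. -/
def plus (M : IsoMesh k Ω) (e : M.EdgeIndex) : IsoElement k := M.elem e.2.1

/-- The edge as a closed set of points. -/
def edgeSet (M : IsoMesh k Ω) (e : M.EdgeIndex) : Set Plane := (M.elem e.1).edge e.2.2

/-- The edge without its endpoints. -/
def openEdgeSet (M : IsoMesh k Ω) (e : M.EdgeIndex) : Set Plane := (M.elem e.1).openEdge e.2.2

/-- The diameter `h_e`. -/
def edgeDiam (M : IsoMesh k Ω) (e : M.EdgeIndex) : ℝ := Metric.diam (M.edgeSet e)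

/-- The fixed unit normal `n_e`. -/
def edgeNormal (M : IsoMesh k Ω) (e : M.EdgeIndex) (x : Plane) : Fin 2 → ℝ :=
  (M.elem e.1).unitNormal e.2.2 x

open Classical in
/-- The interior edges: those common to two elements and, up to their endpoints, inside `Ω`. The
condition `i < j` makes every edge occur once and fixes the direction of its normal. -/
def interiorEdges (M : IsoMesh k Ω) : Finset M.EdgeIndex :=
  Finset.univ.filter fun e => e.1 < e.2.1 ∧
    (M.minus e).carrier ∩ (M.plus e).carrier = M.edgeSet e ∧
    (∃ b, M.edgeSet e = (M.plus e).edge b) ∧ M.openEdgeSet e ⊆ Ω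

/-- The crease is resolved by the mesh: it is made of interior edges (up to endpoints). -/
def Resolves (M : IsoMesh k Ω) (crease : Set Plane) : Prop :=
  (crease ⊆ ⋃ e ∈ M.interiorEdges, M.edgeSet e) ∧
  ∀ e ∈ M.interiorEdges, M.openEdgeSet e ⊆ crease ∨ Disjoint (M.openEdgeSet e) crease

open Classical in
/-- The interior edges that do not lie along the crease. -/
def freeEdges (M : IsoMesh k Ω) (crease : Set Plane) : Finset M.EdgeIndex :=
  M.interiorEdges.filter fun e => ¬ M.openEdgeSet e ⊆ crease

/-- The space `S_h^k` (only the values on the closure of `Ω` matter). -/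
def femSpace (M : IsoMesh k Ω) : Set (Plane → ℝ) :=
  {v | ContinuousOn v (closure Ω) ∧ ∀ i, ∃ p ∈ (M.elem i).ref.polySpace k,
    ∀ z ∈ (M.elem i).ref.cell, v ((M.elem i).map z) = polyEval p z}

/-- The broken space `V_h^ℓ` (the values on the skeleton, a null set, do not matter). -/
def brokenSpace (M : IsoMesh k Ω) (l : ℕ) : Set (Plane → ℝ) :=
  {w | ∀ i, ∃ p ∈ (M.elem i).ref.polySpace l,
    ∀ z ∈ interior (M.elem i).ref.cell, w ((M.elem i).map z) = polyEval p z}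

/-- The space `[V_h^ℓ]^{2×2}`. -/
def brokenMatrixSpace (M : IsoMesh k Ω) (l : ℕ) : Set (Plane → Matrix (Fin 2) (Fin 2) ℝ) :=
  {τ | ∀ a b, (fun x => τ x a b) ∈ M.brokenSpace l}

/-- The jump `[w] = w⁻ - w⁺` over an edge. -/
def jump (M : IsoMesh k Ω) (e : M.EdgeIndex) (w : Plane → ℝ) (x : Plane) : ℝ :=
  traceFrom (M.minus e).openCell w x - traceFrom (M.plus e).openCell w x

/-- The average `{w} = (w⁺ + w⁻) / 2` on an edge. -/
def avg (M : IsoMesh k Ω) (e : M.EdgeIndex) (w : Plane → ℝ) (x : Plane) : ℝ :=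
  (traceFrom (M.plus e).openCell w x + traceFrom (M.minus e).openCell w x) / 2

/-- The jump of the gradient `[∇v]` over an edge. -/
def jumpGrad (M : IsoMesh k Ω) (e : M.EdgeIndex) (v : Plane → ℝ) (x : Plane) : Fin 2 → ℝ :=
  fun j => M.jump e (fun z => grad v z j) x

/-- The average of a matrix field on an edge. -/
def avgMatrix (M : IsoMesh k Ω) (e : M.EdgeIndex) (τ : Plane → Matrix (Fin 2) (Fin 2) ℝ)
    (x : Plane) : Matrix (Fin 2) (Fin 2) ℝ :=
  Matrix.of fun a b => M.avg e (fun z => τ z a b) x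

/-- `r` is the local lifting `r_e(φ)`: it belongs to `[V_h^ℓ]^{2×2}`, vanishes outside the union
`ω_e` of the two elements sharing `e`, and
`∫_{ω_e} r : τ = ∫_e {τ} n_e · φ` for all `τ ∈ [V_h^ℓ]^{2×2}`. The integral over `e` is with
respect to arc length, that is, the one-dimensional Hausdorff measure. -/
def IsLocalLifting (M : IsoMesh k Ω) (l : ℕ) (e : M.EdgeIndex) (φ : Plane → Fin 2 → ℝ)
    (r : Plane → Matrix (Fin 2) (Fin 2) ℝ) : Prop :=
  r ∈ M.brokenMatrixSpace l ∧
  (∀ x, x ∉ (M.minus e).carrier ∪ (M.plus e).carrier → r x = 0) ∧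
  ∀ τ ∈ M.brokenMatrixSpace l,
    ∫ x in (M.minus e).carrier ∪ (M.plus e).carrier, frobInner (r x) (τ x) =
      ∫ x in M.edgeSet e, (M.avgMatrix e τ x).mulVec (M.edgeNormal e x) ⬝ᵥ φ x
        ∂(Measure.hausdorffMeasure 1)

open Classical in
/-- The local lifting `r_e(φ)`, which by the Riesz theorem in the finite-dimensional space
`[V_h^ℓ]^{2×2}` on `ω_e` exists, and is unique almost everywhere, for all `φ ∈ [L²(e)]²`. -/
def localLifting (M : IsoMesh k Ω) (l : ℕ) (e : M.EdgeIndex) (φ : Plane → Fin 2 → ℝ) :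
    Plane → Matrix (Fin 2) (Fin 2) ℝ :=
  if h : ∃ r, M.IsLocalLifting l e φ r then h.choose else 0

/-- The discrete Hessian `H_h(v) = D_h²v - R_h([∇v])`, where `R_h = ∑ₑ r_e` over the interior
edges that do not lie along the crease. -/
def discreteHessian (M : IsoMesh k Ω) (crease : Set Plane) (l : ℕ) (v : Plane → ℝ) (x : Plane) :
    Matrix (Fin 2) (Fin 2) ℝ :=
  brokenHessian v x - ∑ e ∈ M.freeEdges crease, M.localLifting l e (M.jumpGrad e v) x

/-- `‖𝐡^{-1/2} [∇v]‖²` in `L²(Γ_h^0 \ Σ)`. -/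
def jumpNormSq (M : IsoMesh k Ω) (crease : Set Plane) (v : Plane → ℝ) : ℝ :=
  ∑ e ∈ M.freeEdges crease, ∫ x in M.edgeSet e,
    (M.edgeDiam e)⁻¹ * (M.jumpGrad e v x ⬝ᵥ M.jumpGrad e v x) ∂(Measure.hausdorffMeasure 1)

/-- The squared discrete seminorm `|v|²` in `H_h²(Ω)`. -/
def seminormSq (M : IsoMesh k Ω) (crease : Set Plane) (v : Plane → ℝ) : ℝ :=
  (∫ x in Ω, frobSq (brokenHessian v x)) + M.jumpNormSq crease v

/-- The squared discrete seminorm `|y|²` in `H_h²(Ω)` of a deformation. -/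
def deformationSeminormSq (M : IsoMesh k Ω) (crease : Set Plane) (y : Fin 3 → Plane → ℝ) : ℝ :=
  ∑ m, M.seminormSq crease (y m)

/-- The space `[S_h^k]³`. -/
def deformationSpace (M : IsoMesh k Ω) : Set (Fin 3 → Plane → ℝ) :=
  {y | ∀ m, y m ∈ M.femSpace}

/-- The discrete bending energy `E_h^B`. -/
def bendingEnergy (M : IsoMesh k Ω) (crease : Set Plane) (l : ℕ) (μ lam γ : ℝ)
    (g : Plane → Matrix (Fin 2) (Fin 2) ℝ) (y : Fin 3 → Plane → ℝ) : ℝ :=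
  1 / 24 * (∫ x in Ω,
    (2 * μ * (∑ m, frobSq
        (invSqrt (g x) * M.discreteHessian crease l (y m) x * invSqrt (g x))) +
      2 * μ * lam / (2 * μ + lam) * (∑ m,
        (invSqrt (g x) * M.discreteHessian crease l (y m) x * invSqrt (g x)).trace ^ 2)))
  + γ / 2 * ∑ m, M.jumpNormSq crease (y m)

end IsoMesh

/-- The stretching energy `E_h^S`. -/
def stretchingEnergy (Ω : Set Plane) (μ lam : ℝ) (g : Plane → Matrix (Fin 2) (Fin 2) ℝ)
    (y : Fin 3 → Plane → ℝ) : ℝ :=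
  1 / 8 * (∫ x in Ω,
    (2 * μ * frobSq
        (invSqrt (g x) * ((jac y x).transpose * jac y x - g x) * invSqrt (g x)) +
      lam *
        (invSqrt (g x) * ((jac y x).transpose * jac y x - g x) * invSqrt (g x)).trace ^ 2))

/-- The total discrete energy `E_h = E_h^S + θ² E_h^B`. -/
def IsoMesh.energy {k : ℕ} {Ω : Set Plane} (M : IsoMesh k Ω) (crease : Set Plane) (l : ℕ)
    (μ lam γ θ : ℝ) (g : Plane → Matrix (Fin 2) (Fin 2) ℝ) (y : Fin 3 → Plane → ℝ) : ℝ :=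
  stretchingEnergy Ω μ lam g y + θ ^ 2 * M.bendingEnergy crease l μ lam γ g y

/-- `‖∇y‖²` in `L²(Ω)`. -/
def gradNormSq (Ω : Set Plane) (y : Fin 3 → Plane → ℝ) : ℝ := ∫ x in Ω, frobSq (jac y x)

/-- `‖g‖` in `L^∞(Ω)`. -/
def metricSup (Ω : Set Plane) (g : Plane → Matrix (Fin 2) (Fin 2) ℝ) : ℝ :=
  (eLpNorm (fun x => frobNorm (g x)) ⊤ (volume.restrict Ω)).toReal

/-- `‖g‖` in `L¹(Ω)`. -/
def metricL1 (Ω : Set Plane) (g : Plane → Matrix (Fin 2) (Fin 2) ℝ) : ℝ :=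
  ∫ x in Ω, frobNorm (g x)

/-- A target metric on `Ω`: a bounded measurable field of symmetric, uniformly positive definite
matrices. Only the values almost everywhere in `Ω` matter. -/
structure IsTargetMetric (Ω : Set Plane) (g : Plane → Matrix (Fin 2) (Fin 2) ℝ) : Prop where
  aemeasurable : ∀ a b, AEMeasurable (fun x => g x a b) (volume.restrict Ω)
  bounded : ∃ c : ℝ, ∀ᵐ x ∂(volume.restrict Ω), frobNorm (g x) ≤ c
  symm : ∀ᵐ x ∂(volume.restrict Ω), (g x).IsSymm
  pos : ∃ c : ℝ, 0 < c ∧ ∀ᵐ x ∂(volume.restrict Ω), ∀ ξ : Fin 2 → ℝ,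
    c * (ξ ⬝ᵥ ξ) ≤ ξ ⬝ᵥ (g x).mulVec ξ

/-- Shape regularity of a family of isoparametric meshes: `‖Dψ_T‖ ≲ h_T` and
`‖(Dψ_T)⁻¹‖ ≲ h_T⁻¹`, uniformly over all elements of all meshes of the family. -/
def ShapeRegular {k : ℕ} {Ω : Set Plane} {ι : Type} (M : ι → IsoMesh k Ω) : Prop :=
  ∃ σ : ℝ, ∀ h i, ∀ z ∈ ((M h).elem i).ref.cell,
    frobNorm (((M h).elem i).jacobian z) ≤ σ * ((M h).elem i).diam ∧
    frobNorm (((M h).elem i).jacobian z)⁻¹ ≤ σ * (((M h).elem i).diam)⁻¹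

/-- Quasi-uniformity of a family of meshes: in each mesh all elements have comparable diameters,
uniformly over the family. -/
def QuasiUniform {k : ℕ} {Ω : Set Plane} {ι : Type} (M : ι → IsoMesh k Ω) : Prop :=
  ∃ σ : ℝ, ∀ h i j, ((M h).elem i).diam ≤ σ * ((M h).elem j).diam

end PrestrainedPlate

end

open PrestrainedPlate

noncomputable section

namespace PrestrainedPlate

/-! ### The Frobenius norm -/

section Frobenius

variable {m n : ℕ}

/-! Both energies see their fields only through conjugation by `g^{-1/2}`. The pointwise inequality
`|A| ≤ |g| |g^{-1/2} A g^{-1/2}|` (`invSqrt_facts`, `IsTargetMetric.ae_frobSq_le`) undoes this at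
the price of `‖g‖_∞`.

Gradient bound (`gradNormSq_le`): `|∇y|²` is the trace of `∇yᵀ∇y = (∇yᵀ∇y - g) + g`, hence is
controlled linearly by the metric defect and `g`. The `L¹` norm of the defect is bounded by its `L²`
norm times `|Ω|^{1/2}`, that is, by the square root of the stretching energy. No regularity of the
mesh enters.

Hessian bound (`exists_bending_coercivity`): the broken Hessian is `H_h` plus the liftings. The
bending energy controls `H_h` and, with weight `γ`, the jump term, so what is missing is the bound
of the liftings by the jumps (`exists_lifting_stability`). For one edge, the lifting is tested with
itself. The equivalence of norms on polynomials over the reference cell, scaled to the element,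
bounds its traces by `h_T⁻¹` times its `L²` norm; the edge has length `≲ h_T`, and Young's
inequality absorbs the lifting (`Regular.integral_lifting_le`). Almost every point lies in the
patches of boundedly many edges, by comparing areas (`Regular.card_neighbours_le`), so the local
bounds add up. Controlling the jumps costs `1/γ`, which is why the constant blows up.

The combined bound is the square of the first plus `θ²` times the second.

On curved elements the derivatives of finite element functions are not polynomials after pullback.
The class `SmoothUpTo` is closed under differentiation (`SmoothUpTo.grad`), and it makes every field
bounded and gives continuous traces. -/

lemma frobSq_nonneg (A : Matrix (Fin m) (Fin n) ℝ) : 0 ≤ frobSq A := by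
  unfold frobSq; positivity

lemma frobNorm_nonneg (A : Matrix (Fin m) (Fin n) ℝ) : 0 ≤ frobNorm A := Real.sqrt_nonneg _

lemma frobNorm_sq (A : Matrix (Fin m) (Fin n) ℝ) : frobNorm A ^ 2 = frobSq A :=
  Real.sq_sqrt (frobSq_nonneg A)

lemma sq_entry_le_frobSq (A : Matrix (Fin m) (Fin n) ℝ) (i : Fin m) (j : Fin n) :
    A i j ^ 2 ≤ frobSq A :=
  (Finset.single_le_sum (f := fun j => A i j ^ 2) (fun _ _ => sq_nonneg _)
    (Finset.mem_univ j)).trans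
  (Finset.single_le_sum (f := fun i => ∑ j, A i j ^ 2)
    (fun _ _ => Finset.sum_nonneg fun _ _ => sq_nonneg _) (Finset.mem_univ i))

lemma abs_entry_le_frobNorm (A : Matrix (Fin m) (Fin n) ℝ) (i : Fin m) (j : Fin n) :
    |A i j| ≤ frobNorm A := Real.abs_le_sqrt (sq_entry_le_frobSq A i j)

lemma frobInner_self (A : Matrix (Fin m) (Fin n) ℝ) : frobInner A A = frobSq A := by
  simp [frobInner, frobSq, pow_two]

lemma frobInner_sq_le (A B : Matrix (Fin m) (Fin n) ℝ) :
    frobInner A B ^ 2 ≤ frobSq A * frobSq B := by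
  have := Finset.sum_mul_sq_le_sq_mul_sq (Finset.univ : Finset (Fin m × Fin n))
    (fun p => A p.1 p.2) (fun p => B p.1 p.2)
  simpa only [frobInner, frobSq, Fintype.sum_prod_type] using this

lemma frobSq_mul_le {p : ℕ} (A : Matrix (Fin m) (Fin n) ℝ) (B : Matrix (Fin n) (Fin p) ℝ) :
    frobSq (A * B) ≤ frobSq A * frobSq B := by
  have h : ∀ i j, (A * B) i j ^ 2 ≤ (∑ k, A i k ^ 2) * ∑ k, B k j ^ 2 := fun i j => by
    rw [Matrix.mul_apply]; exact Finset.sum_mul_sq_le_sq_mul_sq _ _ _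
  calc frobSq (A * B) ≤ ∑ i, ∑ j, (∑ k, A i k ^ 2) * ∑ k, B k j ^ 2 :=
        Finset.sum_le_sum fun i _ => Finset.sum_le_sum fun j _ => h i j
    _ = frobSq A * frobSq B := by
        rw [← Finset.sum_mul_sum, frobSq, frobSq, Finset.sum_comm (f := fun k j => B k j ^ 2)]

lemma frobSq_add_le (A B : Matrix (Fin m) (Fin n) ℝ) :
    frobSq (A + B) ≤ 2 * frobSq A + 2 * frobSq B := by
  simp only [frobSq, Finset.mul_sum, ← Finset.sum_add_distrib]
  refine Finset.sum_le_sum fun i _ => Finset.sum_le_sum fun j _ => ?_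
  simp only [Matrix.add_apply]
  nlinarith [sq_nonneg (A i j - B i j)]

lemma frobSq_sum_le {ι : Type*} (s : Finset ι) (A : ι → Matrix (Fin m) (Fin n) ℝ) :
    frobSq (∑ e ∈ s, A e) ≤ s.card * ∑ e ∈ s, frobSq (A e) := by
  have : ∑ e ∈ s, frobSq (A e) = ∑ i, ∑ j, ∑ e ∈ s, A e i j ^ 2 := by
    simp only [frobSq]
    rw [Finset.sum_comm]
    exact Finset.sum_congr rfl fun i _ => Finset.sum_comm
  rw [this]
  simp only [frobSq, Finset.mul_sum (s := Finset.univ), Matrix.sum_apply]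
  exact Finset.sum_le_sum fun i _ => Finset.sum_le_sum fun j _ => sq_sum_le_card_mul_sum_sq

lemma trace_sq_le (A : Matrix (Fin 2) (Fin 2) ℝ) : A.trace ^ 2 ≤ 2 * frobSq A := by
  simp only [Matrix.trace_fin_two, frobSq, Fin.sum_univ_two]
  nlinarith [sq_nonneg (A 0 0 - A 1 1), sq_nonneg (A 0 1), sq_nonneg (A 1 0)]

lemma trace_transpose_mul_self (A : Matrix (Fin m) (Fin n) ℝ) :
    (A.transpose * A).trace = frobSq A := by
  simp only [Matrix.trace, Matrix.diag, Matrix.mul_apply, Matrix.transpose_apply, frobSq, pow_two]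
  exact Finset.sum_comm

end Frobenius

/-! ### The inverse square root of a positive definite matrix -/

/-- The functional calculus is used only here; everything later is algebra with `S`. The signs of
trace and determinant come from the symmetric fourth root `R`: since `S = R R`, the trace of `S` is
`|R|²` and its determinant is `(det R)²`. -/
lemma exists_sqrt (G : Matrix (Fin 2) (Fin 2) ℝ) (hG : G.IsSymm) {c : ℝ} (hc : 0 < c)
    (hpos : ∀ ξ : Fin 2 → ℝ, c * (ξ ⬝ᵥ ξ) ≤ ξ ⬝ᵥ G.mulVec ξ) :
    ∃ S : Matrix (Fin 2) (Fin 2) ℝ, invSqrt G = S⁻¹ ∧ S.transpose = S ∧ S * S = G ∧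
      0 ≤ S.trace ∧ 0 ≤ S.det := by
  have hself : IsSelfAdjoint G := by
    rw [IsSelfAdjoint, Matrix.star_eq_conjTranspose, Matrix.conjTranspose_eq_transpose_of_trivial]
    exact hG
  have hpsd : G.PosSemidef := by
    refine Matrix.PosSemidef.of_dotProduct_mulVec_nonneg hself fun ξ => ?_
    have h := hpos ξ
    have h0 : 0 ≤ ξ ⬝ᵥ ξ := by
      simp only [dotProduct]; exact Finset.sum_nonneg fun i _ => mul_self_nonneg _
    simpa using (mul_nonneg hc.le h0).trans h
  have hspec : ∀ x ∈ spectrum ℝ G, 0 ≤ x :=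
    (Matrix.posSemidef_iff_isHermitian_and_spectrum_nonneg.1 hpsd).2
  set R := cfc (fun x => √√x) G with hR
  have hRt : R.transpose = R := by
    have : IsSelfAdjoint R := cfc_predicate _ _
    rwa [IsSelfAdjoint, Matrix.star_eq_conjTranspose,
      Matrix.conjTranspose_eq_transpose_of_trivial] at this
  have hRR : R * R = cfc Real.sqrt G := by
    rw [hR, ← cfc_mul _ _ G (by fun_prop) (by fun_prop)]
    exact cfc_congr fun x _ => Real.mul_self_sqrt (Real.sqrt_nonneg x)
  have hSS : cfc Real.sqrt G * cfc Real.sqrt G = G := by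
    rw [← cfc_mul _ _ G (by fun_prop) (by fun_prop)]
    conv_rhs => rw [← cfc_id ℝ G]
    exact cfc_congr fun x hx => Real.mul_self_sqrt (hspec x hx)
  refine ⟨_, rfl, ?_, hSS, ?_, ?_⟩
  · rw [← hRR, Matrix.transpose_mul, hRt]
  · rw [← hRR]; nth_rw 1 [← hRt]
    rw [trace_transpose_mul_self]; exact frobSq_nonneg _
  · rw [← hRR, Matrix.det_mul]; exact mul_self_nonneg _

lemma sq_le_det (G : Matrix (Fin 2) (Fin 2) ℝ) (hG : G.IsSymm) {c : ℝ} (hc : 0 < c)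
    (hpos : ∀ ξ : Fin 2 → ℝ, c * (ξ ⬝ᵥ ξ) ≤ ξ ⬝ᵥ G.mulVec ξ) : c ^ 2 ≤ G.det := by
  have hs : G 1 0 = G 0 1 := hG.apply 0 1
  have h1 := hpos ![1, 0]
  -- At this vector the quadratic form equals `G 0 0 * det G`, while its squared length is at least
  -- `(G 0 0)²`; hence `c * G 0 0 ≤ det G`. The first test vector gives `c ≤ G 0 0`.
  have h2 := hpos ![-G 0 1, G 0 0]
  simp only [dotProduct, Matrix.mulVec, Fin.sum_univ_two, Matrix.cons_val_zero,
    Matrix.cons_val_one, hs] at h1 h2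
  rw [Matrix.det_fin_two, hs]
  have h1' : c ≤ G 0 0 := by linarith
  have ha : 0 < G 0 0 := hc.trans_le h1'
  have h3 : c * G 0 0 ^ 2 ≤ G 0 0 * (G 0 0 * G 1 1 - G 0 1 * G 0 1) := by
    nlinarith [mul_nonneg hc.le (sq_nonneg (G 0 1))]
  have h4 : c * G 0 0 ≤ G 0 0 * G 1 1 - G 0 1 * G 0 1 := by
    by_contra! h
    nlinarith [mul_lt_mul_of_pos_left h ha]
  nlinarith

/-- The entries of `G^{-1/2}`, by the Cayley–Hamilton theorem. -/
def invSqrtFormula (G : Matrix (Fin 2) (Fin 2) ℝ) : Matrix (Fin 2) (Fin 2) ℝ :=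
  (√(G.trace + 2 * √G.det) * √G.det)⁻¹ •
    !![G 1 1 + √G.det, -G 0 1; -G 1 0, G 0 0 + √G.det]

/-- The explicit formula serves for measurability of `g^{-1/2}`, the norm identity for its
boundedness, and the last inequality for removing the conjugation. All follow by writing the entries
of `G` through those of its square root `S`, with `det G = (det S)²` and `tr G + 2 det S = (tr S)²`.
-/
lemma invSqrt_facts (G : Matrix (Fin 2) (Fin 2) ℝ) (hG : G.IsSymm) {c : ℝ} (hc : 0 < c)
    (hpos : ∀ ξ : Fin 2 → ℝ, c * (ξ ⬝ᵥ ξ) ≤ ξ ⬝ᵥ G.mulVec ξ) :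
    invSqrt G = invSqrtFormula G ∧ frobSq (invSqrt G) = G.trace / G.det ∧
    ∀ A : Matrix (Fin 2) (Fin 2) ℝ,
      frobSq A ≤ frobSq G * frobSq (invSqrt G * A * invSqrt G) := by
  obtain ⟨S, hS, hSt, hSS, htr, hdet⟩ := exists_sqrt G hG hc hpos
  have hd : 0 < G.det := (by positivity : 0 < c ^ 2).trans_le (sq_le_det G hG hc hpos)
  have hd2 : S.det ^ 2 = G.det := by rw [← hSS, Matrix.det_mul, sq]
  have hS0 : 0 < S.det := by
    rcases hdet.eq_or_lt with h | h
    · rw [← h] at hd2; norm_num at hd2; linarith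
    · exact h
  have hsd : √G.det = S.det := by rw [← hd2, Real.sqrt_sq hdet]
  have hunit : IsUnit S.det := hS0.ne'.isUnit
  have hsym : S 1 0 = S 0 1 := by conv_lhs => rw [← hSt, Matrix.transpose_apply]
  have e00 : G 0 0 = S 0 0 ^ 2 + S 0 1 ^ 2 := by
    rw [← hSS, Matrix.mul_apply, Fin.sum_univ_two, hsym]; ring
  have e01 : G 0 1 = S 0 1 * (S 0 0 + S 1 1) := by
    rw [← hSS, Matrix.mul_apply, Fin.sum_univ_two]; ring
  have e10 : G 1 0 = S 0 1 * (S 0 0 + S 1 1) := by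
    rw [← hSS, Matrix.mul_apply, Fin.sum_univ_two, hsym]; ring
  have e11 : G 1 1 = S 0 1 ^ 2 + S 1 1 ^ 2 := by
    rw [← hSS, Matrix.mul_apply, Fin.sum_univ_two, hsym]; ring
  have hdS : S.det = S 0 0 * S 1 1 - S 0 1 ^ 2 := by rw [Matrix.det_fin_two, hsym]; ring
  have htS : S.trace = S 0 0 + S 1 1 := Matrix.trace_fin_two S
  have htr2 : G.trace + 2 * S.det = S.trace ^ 2 := by
    rw [Matrix.trace_fin_two, e00, e11, hdS, htS]; ring
  -- A symmetric matrix with trace zero has determinant `-(S 0 0)² - (S 0 1)²`, which is not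
  -- positive.
  have ht0 : 0 < S.trace := by
    rcases htr.eq_or_lt with h | h
    · exfalso
      rw [← h] at htS
      have : S 1 1 = - S 0 0 := by linarith
      rw [this] at hdS
      nlinarith [sq_nonneg (S 0 0), sq_nonneg (S 0 1)]
    · exact h
  have hst : √(G.trace + 2 * √G.det) = S.trace := by rw [hsd, htr2, Real.sqrt_sq htr]
  have hinv : S⁻¹ = S.det⁻¹ • !![S 1 1, -S 0 1; -S 0 1, S 0 0] := by
    rw [Matrix.inv_def, Ring.inverse_eq_inv', Matrix.adjugate_fin_two, hsym]
  refine ⟨?_, ?_, ?_⟩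
  · rw [hS, invSqrtFormula, hst, hsd, hinv]
    ext i j
    have h0 := hS0.ne'
    have h1 := ht0.ne'
    fin_cases i <;> fin_cases j <;> simp <;> field_simp <;>
      simp only [e00, e01, e10, e11, hdS, htS] <;> ring
  · rw [hS, hinv, ← hd2, Matrix.trace_fin_two, e00, e11]
    have h0 := hS0.ne'
    simp [frobSq, Fin.sum_univ_two]
    field_simp
    ring
  · intro A
    rw [hS]
    set B := S⁻¹ * A * S⁻¹ with hB
    have hA : A = S * B * S := by
      rw [hB, ← mul_assoc, ← mul_assoc, Matrix.mul_nonsing_inv _ hunit, one_mul, mul_assoc,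
        Matrix.nonsing_inv_mul _ hunit, mul_one]
    -- With `A = S B S` and cyclicity of the trace, `tr (S B S S Bᵀ S) = tr (G B G Bᵀ)`. The square
    -- roots pair up to `G`, and Cauchy–Schwarz then gives the factor `|G|²`.
    have key : frobSq A = frobInner (G * B) (B * G) := by
      have h1 : frobSq A = (A * A.transpose).trace := by
        rw [Matrix.trace_mul_comm, trace_transpose_mul_self]
      have h2 : frobInner (G * B) (B * G) = ((G * B) * (B * G).transpose).trace := by
        simp [frobInner, Matrix.trace, Matrix.mul_apply]
        ring
      have h3 : G.transpose = G := hG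
      rw [h1, h2, Matrix.transpose_mul, h3, hA]
      simp only [Matrix.transpose_mul, hSt]
      rw [← hSS]
      simp only [mul_assoc]
      conv_rhs => rw [Matrix.trace_mul_comm S]; simp only [mul_assoc]
    have hcs := frobInner_sq_le (G * B) (B * G)
    rw [← key] at hcs
    have hle := mul_le_mul (frobSq_mul_le G B) (frobSq_mul_le B G) (frobSq_nonneg _)
      (mul_nonneg (frobSq_nonneg _) (frobSq_nonneg _))
    refine le_of_sq_le_sq ?_ (mul_nonneg (frobSq_nonneg _) (frobSq_nonneg _))
    nlinarith

/-! ### Polynomials as functions on the plane -/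

lemma contDiff_polyEval (p : MvPolynomial (Fin 2) ℝ) {n : WithTop ℕ∞} :
    ContDiff ℝ n (polyEval p) := by
  induction p using MvPolynomial.induction_on with
  | C a =>
    have : polyEval (MvPolynomial.C a) = fun _ => a := by ext x; simp [polyEval]
    rw [this]; exact contDiff_const
  | add p q hp hq =>
    have : polyEval (p + q) = fun x => polyEval p x + polyEval q x := by ext x; simp [polyEval]
    rw [this]; exact hp.add hq
  | mul_X p i hp =>
    have : polyEval (p * MvPolynomial.X i) = fun x => polyEval p x * x i := by
      ext x; simp [polyEval]
    rw [this]; exact hp.mul (by fun_prop)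

lemma fderiv_polyEval (p : MvPolynomial (Fin 2) ℝ) (x : Plane) (j : Fin 2) :
    fderiv ℝ (polyEval p) x (EuclideanSpace.single j 1) =
      polyEval (MvPolynomial.pderiv j p) x := by
  have hd : ∀ p, DifferentiableAt ℝ (polyEval p) x := fun p =>
    ((contDiff_polyEval p (n := 1)).differentiable one_ne_zero) x
  induction p using MvPolynomial.induction_on with
  | C a =>
    have : polyEval (MvPolynomial.C a) = fun _ => a := by ext x; simp [polyEval]
    simp [this, polyEval]
  | add p q hp hq =>
    have : polyEval (p + q) = fun x => polyEval p x + polyEval q x := by ext x; simp [polyEval]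
    rw [this, fderiv_fun_add (hd p) (hd q)]
    simp [hp, hq, polyEval]
  | mul_X p i hp =>
    have : polyEval (p * MvPolynomial.X i) = fun x => polyEval p x * x i := by
      ext x; simp [polyEval]
    have hX : HasFDerivAt (fun x : Plane => x i) (EuclideanSpace.proj (𝕜 := ℝ) i) x :=
      (EuclideanSpace.proj (𝕜 := ℝ) i).hasFDerivAt
    rw [this, fderiv_fun_mul (hd p) hX.differentiableAt, hX.fderiv]
    simp [hp, polyEval, MvPolynomial.pderiv_X, Pi.single_apply]
    by_cases h : i = j
    · subst h; simp
    · simp [h]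

/-! ### Reference cells -/

namespace RefCell

variable (s : RefCell)

lemma isCompact_cell : IsCompact s.cell := (Set.finite_range _).isCompact_convexHull ℝ

lemma convex_cell : Convex ℝ s.cell := convex_convexHull ℝ _

/-- The unit triangle serves as a common inner cell, both for nonempty interior and for a lower area
bound valid for both shapes. -/
lemma triangle_cell_subset : triangle.cell ⊆ s.cell := by
  cases s with
  | triangle => exact subset_rfl
  | quadrilateral =>
    refine convexHull_mono ?_
    rintro _ ⟨a, rfl⟩
    fin_cases a
    exacts [⟨(0 : Fin 4), rfl⟩, ⟨(1 : Fin 4), rfl⟩, ⟨(3 : Fin 4), rfl⟩]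

lemma nonempty_interior_cell : (interior s.cell).Nonempty := by
  refine Set.Nonempty.mono (interior_mono s.triangle_cell_subset) ?_
  let U : Set Plane := {x | 0 < x 0 ∧ 0 < x 1 ∧ x 0 + x 1 < 1}
  have hU : IsOpen U := by
    exact (isOpen_lt (f := fun _ : Plane => (0 : ℝ)) (g := fun x : Plane => x 0)
      (by fun_prop) (by fun_prop)).inter
      ((isOpen_lt (f := fun _ : Plane => (0 : ℝ)) (g := fun x : Plane => x 1)
      (by fun_prop) (by fun_prop)).inter (isOpen_lt (f := fun x : Plane => x 0 + x 1)
      (g := fun _ : Plane => (1 : ℝ)) (by fun_prop) (by fun_prop)))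
  refine ⟨!₂[1/4, 1/4], mem_interior.2 ⟨U, ?_, hU, ?_⟩⟩
  · rintro x ⟨h0, h1, h2⟩
    have hv : ∀ a : Fin 3, triangle.vertex a ∈ triangle.cell := fun a =>
      subset_convexHull ℝ _ ⟨a, rfl⟩
    have := (convex_cell triangle).sum_mem (t := Finset.univ)
      (w := ![1 - x 0 - x 1, x 0, x 1]) (z := triangle.vertex)
      (by intro i _; fin_cases i <;> simp <;> linarith)
      (by simp [Fin.sum_univ_three]; ring) (fun i _ => hv i)
    convert this
    ext i
    fin_cases i <;> simp [Fin.sum_univ_three, vertex]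
  · simp only [U, Set.mem_ofPred_eq]; norm_num

lemma closure_interior_cell : closure (interior s.cell) = s.cell := by
  rw [s.convex_cell.closure_interior_eq_closure_of_nonempty_interior s.nonempty_interior_cell,
    s.isCompact_cell.isClosed.closure_eq]

lemma vertex_mem_cell (a : Fin s.numVertices) : s.vertex a ∈ s.cell :=
  subset_convexHull ℝ _ ⟨a, rfl⟩

lemma edge_subset_cell (a : Fin s.numVertices) : s.edge a ⊆ s.cell :=
  s.convex_cell.segment_subset (s.vertex_mem_cell _) (s.vertex_mem_cell _)

lemma isCompact_edge (a : Fin s.numVertices) : IsCompact (s.edge a) := by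
  rw [edge, segment_eq_image_lineMap]
  exact isCompact_Icc.image (by fun_prop)

lemma volume_edge (a : Fin s.numVertices) : volume (s.edge a) = 0 := by
  set p := s.vertex a
  set q := s.vertex (finRotate _ a)
  have h : s.edge a ⊆ (line[ℝ, p, q] : Set Plane) := by
    rw [edge, ← convexHull_pair]; exact convexHull_subset_affineSpan _
  refine measure_mono_null h (Measure.addHaar_affineSubspace volume _ fun htop => ?_)
  have h1 : Module.finrank ℝ (line[ℝ, p, q]).direction ≤ 1 := by
    rw [direction_affineSpan, vectorSpan_pair]; exact (finrank_span_le_card _).trans (by simp)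
  rw [htop, AffineSubspace.direction_top, finrank_top] at h1
  simp at h1

end RefCell

/-! ### Isoparametric elements -/

namespace IsoElement

variable {k : ℕ} (T : IsoElement k)

lemma contDiff_map {n : WithTop ℕ∞} : ContDiff ℝ n T.map := by
  rw [contDiff_euclidean]
  intro i
  fin_cases i
  · exact contDiff_polyEval (T.ψ 0)
  · exact contDiff_polyEval (T.ψ 1)

lemma continuous_map : Continuous T.map := (T.contDiff_map (n := 0)).continuous

/-- This identifies the matrix of formal partial derivatives with the true derivative, so that
`det_ne_zero` gives access to the inverse function theorem and to the change of variables. -/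
lemma fderiv_map (z : Plane) :
    fderiv ℝ T.map z = Matrix.toEuclideanCLM (𝕜 := ℝ) (T.jacobian z) := by
  have hd : DifferentiableAt ℝ T.map z := (T.contDiff_map (n := 1)).differentiable one_ne_zero z
  have hcomp : ∀ (i : Fin 2) (v : Plane), (fderiv ℝ T.map z v) i =
      fderiv ℝ (polyEval (T.ψ i)) z v := by
    intro i v
    have h := ((EuclideanSpace.proj (𝕜 := ℝ) i).hasFDerivAt.comp z hd.hasFDerivAt).fderiv
    have e : (⇑(EuclideanSpace.proj (𝕜 := ℝ) i) ∘ T.map) = polyEval (T.ψ i) := by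
      ext x; fin_cases i <;> simp [map]
    rw [e] at h
    rw [h]; rfl
  have hs : ∀ j, fderiv ℝ T.map z (EuclideanSpace.single j 1) =
      Matrix.toEuclideanCLM (𝕜 := ℝ) (T.jacobian z) (EuclideanSpace.single j 1) := by
    intro j
    ext i
    rw [hcomp, fderiv_polyEval, Matrix.ofLp_toEuclideanCLM]
    simp [jacobian]
  refine ContinuousLinearMap.coe_injective
    ((EuclideanSpace.basisFun (Fin 2) ℝ).toBasis.ext fun j => ?_)
  simpa using hs j

lemma det_fderiv_map (z : Plane) : (fderiv ℝ T.map z).det = (T.jacobian z).det := by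
  rw [fderiv_map, ContinuousLinearMap.det, Matrix.coe_toEuclideanCLM_eq_toEuclideanLin]
  exact LinearMap.det_toLin (PiLp.basisFun 2 ℝ (Fin 2)) _

lemma exists_equiv {z : Plane} (hz : z ∈ T.ref.cell) :
    ∃ L : Plane ≃L[ℝ] Plane, (L : Plane →L[ℝ] Plane) = fderiv ℝ T.map z := by
  have h : (fderiv ℝ T.map z).det ≠ 0 := by rw [det_fderiv_map]; exact T.det_ne_zero z hz
  exact ⟨_, ContinuousLinearMap.coe_toContinuousLinearEquivOfDetNeZero _ h⟩

lemma injOn_map : Set.InjOn T.map T.ref.cell := T.injOn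

lemma inv_map {z : Plane} (hz : z ∈ T.ref.cell) : T.inv (T.map z) = z :=
  T.injOn_map.leftInvOn_invFunOn hz

lemma map_inv {x : Plane} (hx : x ∈ T.carrier) : T.map (T.inv x) = x :=
  Function.invFunOn_eq hx

lemma inv_mem {x : Plane} (hx : x ∈ T.carrier) : T.inv x ∈ T.ref.cell :=
  Function.invFunOn_mem hx

lemma isCompact_carrier : IsCompact T.carrier := T.ref.isCompact_cell.image T.continuous_map

lemma openCell_subset_carrier : T.openCell ⊆ T.carrier := Set.image_mono interior_subset

/-- A continuous injection on a compact set is closed: the preimage of a closed set under the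
inverse is the image of a compact set. -/
lemma continuousOn_inv : ContinuousOn T.inv T.carrier := by
  rw [continuousOn_iff_isClosed]
  intro t ht
  refine ⟨T.map '' (T.ref.cell ∩ t),
    ((T.ref.isCompact_cell.inter_right ht).image T.continuous_map).isClosed, ?_⟩
  ext x
  constructor
  · rintro ⟨h1, h2⟩
    exact ⟨⟨T.inv x, ⟨T.inv_mem h2, h1⟩, T.map_inv h2⟩, h2⟩
  · rintro ⟨⟨z, ⟨hz, hzt⟩, rfl⟩, h2⟩
    refine ⟨?_, h2⟩
    rw [Set.mem_preimage, T.inv_map hz]; exact hzt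

lemma hasStrictFDerivAt_map (z : Plane) : HasStrictFDerivAt T.map (fderiv ℝ T.map z) z :=
  (T.contDiff_map (n := 1)).contDiffAt.hasStrictFDerivAt one_ne_zero

/-- By the inverse function theorem the map is open at every interior point. -/
lemma isOpen_openCell : IsOpen T.openCell := by
  rw [isOpen_iff_mem_nhds]
  rintro _ ⟨z, hz, rfl⟩
  obtain ⟨L, hL⟩ := T.exists_equiv (interior_subset hz)
  have h := T.hasStrictFDerivAt_map z
  rw [← hL] at h
  rw [← h.map_nhds_eq_of_equiv]
  exact image_mem_map (isOpen_interior.mem_nhds hz)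

/-- This makes the filter in the definition of the trace nontrivial at every point of the closed
element, edges included. -/
lemma carrier_subset_closure_openCell : T.carrier ⊆ closure T.openCell := by
  rw [carrier, ← T.ref.closure_interior_cell]
  exact image_closure_subset_closure_image T.continuous_map

lemma volume_image_eq_zero {s : Set Plane} (hs : volume s = 0) : volume (T.map '' s) = 0 :=
  addHaar_image_eq_zero_of_differentiableOn_of_addHaar_eq_zero volume
    ((T.contDiff_map (n := 1)).differentiable one_ne_zero).differentiableOn hs

/-- The frontier of a convex set is null, and differentiable maps preserve null sets. -/
lemma volume_carrier_diff_openCell : volume (T.carrier \ T.openCell) = 0 := by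
  refine measure_mono_null ?_ (T.volume_image_eq_zero
    (T.ref.convex_cell.addHaar_frontier volume))
  rintro _ ⟨⟨z, hz, rfl⟩, h2⟩
  refine ⟨z, ⟨subset_closure hz, fun h => h2 ⟨z, h, rfl⟩⟩, rfl⟩

lemma edge_subset_carrier (a : Fin T.ref.numVertices) : T.edge a ⊆ T.carrier :=
  Set.image_mono (T.ref.edge_subset_cell a)

lemma isCompact_edge (a : Fin T.ref.numVertices) : IsCompact (T.edge a) :=
  (T.ref.isCompact_edge a).image T.continuous_map

lemma volume_edge (a : Fin T.ref.numVertices) : volume (T.edge a) = 0 :=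
  T.volume_image_eq_zero (T.ref.volume_edge a)

/-! ### Functions that are smooth up to the boundary of an element -/

/-- `w` pulls back to a function that is smooth up to the boundary of the reference cell. -/
def SmoothUpTo (w : Plane → ℝ) : Prop :=
  ∃ q : Plane → ℝ, (∀ z ∈ T.ref.cell, ContDiffAt ℝ (⊤ : ℕ∞) q z) ∧
    ∀ z ∈ interior T.ref.cell, w (T.map z) = q z

lemma smoothUpTo_of_polyEval {w : Plane → ℝ} (p : MvPolynomial (Fin 2) ℝ)
    (h : ∀ z ∈ interior T.ref.cell, w (T.map z) = polyEval p z) : T.SmoothUpTo w :=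
  ⟨polyEval p, fun _ _ => (contDiff_polyEval p).contDiffAt, h⟩

variable {T}

/-- By the chain rule, `∂ⱼw` pulls back to `Dq` applied to `(Dψ)⁻¹ eⱼ`. This is smooth up to the
boundary because inversion is smooth at invertible maps and `Dψ` is invertible on the closed cell.
Two applications cover the broken Hessian. -/
lemma SmoothUpTo.grad {w : Plane → ℝ} (h : T.SmoothUpTo w) (j : Fin 2) :
    T.SmoothUpTo fun x => grad w x j := by
  obtain ⟨q, hq, hw⟩ := h
  refine ⟨fun z => fderiv ℝ q z ((fderiv ℝ T.map z).inverse (EuclideanSpace.single j 1)),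
    fun z hz => ?_, fun z hz => ?_⟩
  · obtain ⟨L, hL⟩ := T.exists_equiv hz
    have h1 : ContDiffAt ℝ (⊤ : ℕ∞) (fderiv ℝ q) z := (hq z hz).fderiv_right (by simp)
    have h2 : ContDiffAt ℝ (⊤ : ℕ∞) (fderiv ℝ T.map) z :=
      (T.contDiff_map (n := (⊤ : ℕ∞))).contDiffAt.fderiv_right (by simp)
    have h3 : ContDiffAt ℝ (⊤ : ℕ∞) ContinuousLinearMap.inverse (fderiv ℝ T.map z) := by
      rw [← hL]; exact contDiffAt_map_inverse L
    exact h1.clm_apply ((h3.comp z h2).clm_apply contDiffAt_const)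
  · have hz' := interior_subset hz
    obtain ⟨L, hL⟩ := T.exists_equiv hz'
    have hm := T.hasStrictFDerivAt_map z
    rw [← hL] at hm
    have hnhds : ∀ᶠ y in 𝓝 z, y ∈ interior T.ref.cell := isOpen_interior.mem_nhds hz
    have hi : HasStrictFDerivAt T.inv (L.symm : Plane →L[ℝ] Plane) (T.map z) :=
      hm.to_local_left_inverse (hnhds.mono fun y hy => T.inv_map (interior_subset hy))
    have hqz : HasFDerivAt q (fderiv ℝ q z) (T.inv (T.map z)) := by
      rw [T.inv_map hz']
      exact ((hq z hz').differentiableAt (by simp)).hasFDerivAt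
    have hcomp := hqz.comp (T.map z) hi.hasFDerivAt
    have heq : w =ᶠ[𝓝 (T.map z)] q ∘ T.inv := by
      filter_upwards [T.isOpen_openCell.mem_nhds ⟨z, hz, rfl⟩]
      rintro _ ⟨y, hy, rfl⟩
      rw [Function.comp_apply, T.inv_map (interior_subset hy), hw y hy]
    simp only [PrestrainedPlate.grad]
    rw [(hcomp.congr_of_eventuallyEq heq).fderiv, ← hL,
      ContinuousLinearMap.inverse_equiv]
    rfl

/-- The trace on the closed element is a continuous function. -/
lemma SmoothUpTo.exists_trace {w : Plane → ℝ} (h : T.SmoothUpTo w) :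
    ContinuousOn (traceFrom T.openCell w) T.carrier ∧
      Set.EqOn (traceFrom T.openCell w) w T.openCell := by
  obtain ⟨q, hq, hw⟩ := h
  have hqc : ContinuousOn (q ∘ T.inv) T.carrier :=
    ContinuousOn.comp (t := T.ref.cell) (fun z hz => (hq z hz).continuousAt.continuousWithinAt)
      T.continuousOn_inv fun x hx => T.inv_mem hx
  have heq : Set.EqOn w (q ∘ T.inv) T.openCell := by
    rintro _ ⟨y, hy, rfl⟩
    rw [Function.comp_apply, T.inv_map (interior_subset hy), hw y hy]
  have htr : Set.EqOn (traceFrom T.openCell w) (q ∘ T.inv) T.carrier := by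
    intro x hx
    have : (𝓝[T.openCell] x).NeBot :=
      mem_closure_iff_nhdsWithin_neBot.1 (T.carrier_subset_closure_openCell hx)
    refine Filter.Tendsto.limUnder_eq ?_
    refine ((hqc x hx).mono T.openCell_subset_carrier).tendsto.congr' ?_
    filter_upwards [self_mem_nhdsWithin] with y hy
    exact (heq hy).symm
  exact ⟨hqc.congr htr, fun x hx =>
    (htr (T.openCell_subset_carrier hx)).trans (heq hx).symm⟩

/-- Values of the trace of a function given by a polynomial. -/
lemma traceFrom_map {w : Plane → ℝ} {p : MvPolynomial (Fin 2) ℝ}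
    (h : ∀ z ∈ interior T.ref.cell, w (T.map z) = polyEval p z) {z : Plane}
    (hz : z ∈ T.ref.cell) : traceFrom T.openCell w (T.map z) = polyEval p z := by
  have ht := (T.smoothUpTo_of_polyEval p h).exists_trace
  have hc : ContinuousOn (fun z => traceFrom T.openCell w (T.map z)) T.ref.cell :=
    ht.1.comp T.continuous_map.continuousOn fun z hz => ⟨z, hz, rfl⟩
  have he : Set.EqOn (fun z => traceFrom T.openCell w (T.map z)) (polyEval p)
      (interior T.ref.cell) := fun y hy => (ht.2 ⟨y, hy, rfl⟩).trans (h y hy)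
  exact he.of_subset_closure hc (contDiff_polyEval p (n := 0)).continuous.continuousOn
    interior_subset T.ref.closure_interior_cell.ge hz

/-- The trace is continuous on a compact set, hence bounded, and differs from `w` at most on the
null boundary. -/
lemma SmoothUpTo.memLp_top {w : Plane → ℝ} (h : T.SmoothUpTo w) :
    MemLp w ⊤ (volume.restrict T.carrier) := by
  obtain ⟨hc, he⟩ := h.exists_trace
  obtain ⟨C, hC⟩ := T.isCompact_carrier.exists_bound_of_continuousOn hc
  have hm := T.isCompact_carrier.measurableSet
  refine MemLp.ae_eq (f := traceFrom T.openCell w) ?_ (memLp_top_of_bound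
    (hc.aestronglyMeasurable hm) C ((ae_restrict_iff' hm).2 (ae_of_all _ hC)))
  rw [EventuallyEq, ae_restrict_iff' hm]
  have := T.volume_carrier_diff_openCell
  rw [measure_eq_zero_iff_ae_notMem] at this
  filter_upwards [this] with x hx hxT
  exact he (by_contra fun h => hx ⟨hxT, h⟩)

end IsoElement

/-! ### Equivalence of norms for polynomials on the reference cells -/

namespace RefCell

/-- Evaluation of polynomials on the reference cell. -/
def evalOnCell (s : RefCell) : MvPolynomial (Fin 2) ℝ →ₗ[ℝ] C(s.cell, ℝ) where
  toFun p := ⟨fun z => polyEval p z,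
    (contDiff_polyEval p (n := 0)).continuous.comp continuous_subtype_val⟩
  map_add' p q := by ext z; simp [polyEval]
  map_smul' c p := by ext z; simp [polyEval]

/-- On polynomials of bounded degree the sup norm is controlled by the `L²` norm. -/
lemma exists_inverse_estimate (s : RefCell) (l : ℕ) : ∃ C : ℝ, 0 < C ∧ ∀ p ∈ s.polySpace l,
    ∀ z ∈ s.cell, polyEval p z ^ 2 ≤ C * ∫ x in s.cell, polyEval p x ^ 2 := by
  have : CompactSpace s.cell := isCompact_iff_compactSpace.1 s.isCompact_cell
  have hmeas : MeasurableSet s.cell := s.isCompact_cell.measurableSet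
  let ν : Measure s.cell := Measure.comap Subtype.val volume
  have hemb : MeasurableEmbedding (Subtype.val : s.cell → Plane) :=
    MeasurableEmbedding.subtype_coe hmeas
  have hν : ∀ U : Set s.cell, ν U = volume (Subtype.val '' U) := fun U =>
    hemb.comap_apply volume U
  have : IsFiniteMeasure ν := ⟨by
    rw [hν]
    exact (measure_mono (by simp : _ ⊆ s.cell)).trans_lt s.isCompact_cell.measure_lt_top⟩
  -- Every point of the cell is a limit of interior points, so a nonempty relatively open subset has
  -- positive area. Continuous functions that agree almost everywhere therefore coincide, and the
  -- passage to `L²` is injective.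
  have : ν.IsOpenPosMeasure := ⟨by
    rintro U hU ⟨x, hx⟩ h0
    obtain ⟨V, hV, rfl⟩ := isOpen_induced_iff.1 hU
    rw [hν] at h0
    have hxc : (x : Plane) ∈ closure (interior s.cell) := by
      rw [s.closure_interior_cell]; exact x.2
    have hne : (V ∩ interior s.cell).Nonempty := mem_closure_iff.1 hxc V hV hx
    refine ((hV.inter isOpen_interior).measure_pos volume hne).ne'
      (measure_mono_null ?_ h0)
    rintro y ⟨hy, hyi⟩
    exact ⟨⟨y, interior_subset hyi⟩, hy, rfl⟩⟩
  have : FiniteDimensional ℝ (s.polySpace l) := by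
    cases s
    · exact (inferInstance : FiniteDimensional ℝ (MvPolynomial.restrictTotalDegree (Fin 2) ℝ l))
    · exact (inferInstance : FiniteDimensional ℝ (MvPolynomial.restrictDegree (Fin 2) ℝ l))
  let U : Submodule ℝ C(s.cell, ℝ) := (s.polySpace l).map s.evalOnCell
  have : FiniteDimensional ℝ U := inferInstance
  let f : U →ₗ[ℝ] Lp ℝ 2 ν := (ContinuousMap.toLp 2 ν ℝ).toLinearMap ∘ₗ U.subtype
  have hf : f.ker = ⊥ := LinearMap.ker_eq_bot.2
    ((ContinuousMap.toLp_injective (p := 2) (𝕜 := ℝ) ν).comp U.injective_subtype)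
  -- An injective linear map on a finite-dimensional space is bounded below; this is the whole
  -- inverse estimate.
  obtain ⟨K, hK, hanti⟩ := LinearMap.exists_antilipschitzWith (𝕜 := ℝ) (E := U) (F := Lp ℝ 2 ν) f hf
  refine ⟨(K : ℝ) ^ 2, by positivity, fun p hp z hz => ?_⟩
  let u : U := ⟨s.evalOnCell p, p, hp, rfl⟩
  have h1 : ‖u‖ ≤ K * ‖f u‖ := by
    have := hanti.le_mul_dist u 0
    simpa using this
  have h2 : |polyEval p z| ≤ ‖u‖ := (s.evalOnCell p).norm_coe_le_norm ⟨z, hz⟩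
  have h3 : ‖f u‖ ^ 2 = ∫ x in s.cell, polyEval p x ^ 2 := by
    rw [← real_inner_self_eq_norm_sq]
    have : f u = ContinuousMap.toLp 2 ν ℝ (s.evalOnCell p) := rfl
    rw [this, ContinuousMap.inner_toLp, ← integral_subtype_comap hmeas]
    simp [evalOnCell, pow_two, ν]
  rw [← h3, ← mul_pow, ← sq_abs]
  exact pow_le_pow_left₀ (abs_nonneg _) (h2.trans h1) 2

end RefCell

/-! ### Scaling of areas, lengths and polynomials on a shape-regular element -/

lemma abs_det_le_frobSq (A : Matrix (Fin 2) (Fin 2) ℝ) : |A.det| ≤ frobSq A := by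
  simp only [Matrix.det_fin_two, frobSq, Fin.sum_univ_two]
  rw [abs_le]
  constructor <;>
  nlinarith [sq_nonneg (A 0 0 - A 1 1), sq_nonneg (A 0 0 + A 1 1), sq_nonneg (A 0 1 - A 1 0),
    sq_nonneg (A 0 1 + A 1 0), sq_nonneg (A 0 0), sq_nonneg (A 0 1), sq_nonneg (A 1 0),
    sq_nonneg (A 1 1)]

lemma norm_toEuclideanCLM_le (A : Matrix (Fin 2) (Fin 2) ℝ) :
    ‖Matrix.toEuclideanCLM (𝕜 := ℝ) A‖ ≤ frobNorm A := by
  refine ContinuousLinearMap.opNorm_le_bound _ (frobNorm_nonneg A) fun x => ?_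
  rw [frobNorm, EuclideanSpace.norm_eq, EuclideanSpace.norm_eq, ← Real.sqrt_mul (frobSq_nonneg A)]
  refine Real.sqrt_le_sqrt ?_
  simp only [Matrix.ofLp_toEuclideanCLM, Real.norm_eq_abs, sq_abs, frobSq, Finset.sum_mul]
  refine Finset.sum_le_sum fun i _ => ?_
  rw [← Finset.sum_mul]
  exact Finset.sum_mul_sq_le_sq_mul_sq Finset.univ (fun j => A i j) (fun j => x j)

namespace IsoElement

variable {k : ℕ} (T : IsoElement k)

lemma diam_pos : 0 < T.diam := by
  have hb := T.isCompact_carrier.isBounded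
  obtain ⟨z, hz⟩ := T.ref.nonempty_interior_cell
  obtain ⟨ε, hε, hball⟩ := Metric.isOpen_iff.1 isOpen_interior z hz
  let y : Plane := z + EuclideanSpace.single 0 (ε / 2)
  have hdist : dist y z = ε / 2 := by simp [y, abs_of_pos hε]
  have hy : y ∈ interior T.ref.cell := hball (by rw [Metric.mem_ball, hdist]; linarith)
  have hne : T.map y ≠ T.map z := fun h => by
    have := T.injOn_map (interior_subset hy) (interior_subset hz) h
    rw [this, dist_self] at hdist
    linarith
  exact (dist_pos.2 hne).trans_le
    (Metric.dist_le_diam_of_mem hb ⟨y, interior_subset hy, rfl⟩ ⟨z, interior_subset hz, rfl⟩)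

/-- The shape of an element is controlled by `σ`. -/
def ShapeBound (σ : ℝ) : Prop :=
  ∀ z ∈ T.ref.cell, frobNorm (T.jacobian z) ≤ σ * T.diam ∧
    frobNorm (T.jacobian z)⁻¹ ≤ σ * T.diam⁻¹

variable {T}

/-- Apply `|det A| ≤ |A|²` to the inverse Jacobian matrix, whose norm is at most `σ / h_T`. -/
lemma ShapeBound.sq_le_det {σ : ℝ} (hσ : 0 < σ) (h : T.ShapeBound σ) {z : Plane}
    (hz : z ∈ T.ref.cell) : T.diam ^ 2 / σ ^ 2 ≤ |(T.jacobian z).det| := by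
  have hd := T.diam_pos
  have h0 : 0 < |(T.jacobian z).det| := abs_pos.2 (T.det_ne_zero z hz)
  have h1 : |(T.jacobian z).det|⁻¹ ≤ σ ^ 2 * (T.diam ^ 2)⁻¹ := by
    have := abs_det_le_frobSq (T.jacobian z)⁻¹
    rw [Matrix.det_nonsing_inv, Ring.inverse_eq_inv', abs_inv, ← frobNorm_sq] at this
    refine this.trans ?_
    rw [← inv_pow, ← mul_pow]
    exact pow_le_pow_left₀ (frobNorm_nonneg _) (h z hz).2 2
  rw [inv_le_comm₀ h0 (by positivity)] at h1
  rwa [mul_inv, inv_inv, mul_comm, ← div_eq_mul_inv] at h1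

/-- Change of variables. -/
lemma setIntegral_carrier (w : Plane → ℝ) :
    ∫ x in T.carrier, w x =
      ∫ z in interior T.ref.cell, |(T.jacobian z).det| * w (T.map z) := by
  have h1 : ∫ x in T.carrier, w x = ∫ x in T.openCell, w x :=
    setIntegral_congr_set (EventuallyLE.antisymm
      (ae_le_set.2 T.volume_carrier_diff_openCell)
      (ae_of_all _ T.openCell_subset_carrier))
  rw [h1, openCell, integral_image_eq_integral_abs_det_fderiv_smul volume
    isOpen_interior.measurableSet
    (fun z _ => (T.hasStrictFDerivAt_map z).hasFDerivAt.hasFDerivWithinAt)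
    (T.injOn_map.mono interior_subset)]
  simp only [det_fderiv_map, smul_eq_mul]

lemma continuous_det : Continuous fun z => |(T.jacobian z).det| := by
  simp only [Matrix.det_fin_two, jacobian, Matrix.of_apply]
  have h : ∀ p, Continuous (polyEval p) := fun p => (contDiff_polyEval p (n := 0)).continuous
  exact (((h _).mul (h _)).sub ((h _).mul (h _))).abs

lemma interior_ae_eq_cell (s : RefCell) : interior s.cell =ᵐ[volume] s.cell := by
  refine EventuallyLE.antisymm (ae_of_all _ interior_subset) (ae_le_set.2 ?_)
  refine measure_mono_null ?_ (s.convex_cell.addHaar_frontier volume)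
  exact Set.sdiff_subset_sdiff_left subset_closure

/-- The inverse estimate on an element. -/
lemma ShapeBound.inverse_estimate {σ : ℝ} (hσ : 0 < σ) (h : T.ShapeBound σ) {C : ℝ} (hC : 0 < C)
    {p : MvPolynomial (Fin 2) ℝ}
    (hp : ∀ z ∈ T.ref.cell, polyEval p z ^ 2 ≤ C * ∫ x in T.ref.cell, polyEval p x ^ 2)
    {w : Plane → ℝ} (hw : ∀ z ∈ interior T.ref.cell, w (T.map z) = polyEval p z) :
    ∀ z ∈ T.ref.cell, polyEval p z ^ 2 ≤
      C * σ ^ 2 * (T.diam ^ 2)⁻¹ * ∫ x in T.carrier, w x ^ 2 := by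
  intro z hz
  have hd := T.diam_pos
  have hcont : Continuous (polyEval p) := (contDiff_polyEval p (n := 0)).continuous
  -- Change of variables with the lower bound for the Jacobian determinant.
  have key : T.diam ^ 2 / σ ^ 2 * ∫ x in T.ref.cell, polyEval p x ^ 2 ≤
      ∫ x in T.carrier, w x ^ 2 := by
    rw [T.setIntegral_carrier, ← setIntegral_congr_set (interior_ae_eq_cell T.ref),
      ← integral_const_mul]
    have hint : ∀ f : Plane → ℝ, Continuous f → IntegrableOn f (interior T.ref.cell) :=
      fun f hf => (hf.continuousOn.integrableOn_compact T.ref.isCompact_cell).mono_set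
        interior_subset
    have e : ∫ y in interior T.ref.cell, |(T.jacobian y).det| * w (T.map y) ^ 2 =
        ∫ y in interior T.ref.cell, |(T.jacobian y).det| * polyEval p y ^ 2 :=
      setIntegral_congr_fun isOpen_interior.measurableSet fun y hy => by simp only [hw y hy]
    rw [e]
    refine setIntegral_mono_on (hint _ (by fun_prop)) (hint _ (continuous_det.mul (by fun_prop)))
      isOpen_interior.measurableSet fun y hy => ?_
    exact mul_le_mul_of_nonneg_right (h.sq_le_det hσ (interior_subset hy)) (sq_nonneg _)
  refine (hp z hz).trans ?_
  have : ∫ x in T.ref.cell, polyEval p x ^ 2 ≤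
      σ ^ 2 * (T.diam ^ 2)⁻¹ * ∫ x in T.carrier, w x ^ 2 := by
    calc ∫ x in T.ref.cell, polyEval p x ^ 2
        = σ ^ 2 * (T.diam ^ 2)⁻¹ *
          (T.diam ^ 2 / σ ^ 2 * ∫ x in T.ref.cell, polyEval p x ^ 2) := by field_simp
      _ ≤ _ := mul_le_mul_of_nonneg_left key (by positivity)
  calc _ ≤ C * (σ ^ 2 * (T.diam ^ 2)⁻¹ * ∫ x in T.carrier, w x ^ 2) :=
        mul_le_mul_of_nonneg_left this hC.le
    _ = _ := by ring

lemma ShapeBound.volume_ge {σ : ℝ} (hσ : 0 < σ) (h : T.ShapeBound σ) :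
    T.diam ^ 2 / σ ^ 2 * volume.real T.ref.cell ≤ volume.real T.carrier := by
  have e : volume.real T.carrier = ∫ x in T.carrier, (1 : ℝ) := by simp
  have e' : T.diam ^ 2 / σ ^ 2 * volume.real T.ref.cell =
      ∫ x in interior T.ref.cell, T.diam ^ 2 / σ ^ 2 := by
    rw [setIntegral_congr_set (interior_ae_eq_cell T.ref)]
    simp [mul_comm]
  rw [e, e', T.setIntegral_carrier]
  have hint : ∀ f : Plane → ℝ, Continuous f → IntegrableOn f (interior T.ref.cell) :=
    fun f hf => (hf.continuousOn.integrableOn_compact T.ref.isCompact_cell).mono_set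
      interior_subset
  refine setIntegral_mono_on (hint _ continuous_const)
    (hint _ (continuous_det.mul continuous_const))
    isOpen_interior.measurableSet fun y hy => ?_
  rw [mul_one]
  exact h.sq_le_det hσ (interior_subset hy)

/-- On the convex reference cell the mean value inequality makes `ψ_T` Lipschitz with constant `σ
h_T`. Hausdorff measure grows at most by this factor, and for a segment it is the length. -/
lemma ShapeBound.hausdorffMeasure_edge_le {σ : ℝ} (hσ : 0 < σ) (h : T.ShapeBound σ)
    (a : Fin T.ref.numVertices) {D : ℝ}
    (hD : dist (T.ref.vertex a) (T.ref.vertex (finRotate _ a)) ≤ D) :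
    Measure.hausdorffMeasure 1 (T.edge a) ≤ ENNReal.ofReal (σ * D * T.diam) := by
  have hd := T.diam_pos
  have hlip : LipschitzOnWith (Real.toNNReal (σ * T.diam)) T.map (T.ref.edge a) := by
    refine LipschitzOnWith.mono ?_ (T.ref.edge_subset_cell a)
    refine T.ref.convex_cell.lipschitzOnWith_of_nnnorm_hasFDerivWithin_le
      (fun z _ => (T.hasStrictFDerivAt_map z).hasFDerivAt.hasFDerivWithinAt) fun z hz => ?_
    rw [← NNReal.coe_le_coe, coe_nnnorm, Real.coe_toNNReal _ (by positivity), fderiv_map]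
    exact (norm_toEuclideanCLM_le _).trans (h z hz).1
  refine (hlip.hausdorffMeasure_image_le zero_le_one).trans ?_
  rw [RefCell.edge, hausdorffMeasure_segment, ENNReal.rpow_one, edist_dist,
    mul_right_comm, ENNReal.ofReal_mul (by positivity)]
  exact mul_le_mul' le_rfl (ENNReal.ofReal_le_ofReal hD)

/-- The qualitative version without shape regularity, which suffices for integrability on edges. -/
lemma hausdorffMeasure_edge_lt_top (a : Fin T.ref.numVertices) :
    Measure.hausdorffMeasure 1 (T.edge a) < ⊤ := by
  obtain ⟨B, hB⟩ := T.ref.isCompact_cell.exists_bound_of_continuousOn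
    (f := fderiv ℝ T.map) ((T.contDiff_map (n := 1)).continuous_fderiv one_ne_zero).continuousOn
  have hlip : LipschitzOnWith (Real.toNNReal B) T.map (T.ref.edge a) := by
    refine LipschitzOnWith.mono ?_ (T.ref.edge_subset_cell a)
    refine T.ref.convex_cell.lipschitzOnWith_of_nnnorm_hasFDerivWithin_le
      (fun z _ => (T.hasStrictFDerivAt_map z).hasFDerivAt.hasFDerivWithinAt) fun z hz => ?_
    rw [← NNReal.coe_le_coe, coe_nnnorm]
    exact (hB z hz).trans (Real.le_coe_toNNReal B)
  refine (hlip.hausdorffMeasure_image_le zero_le_one).trans_lt ?_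
  rw [RefCell.edge, hausdorffMeasure_segment, ENNReal.rpow_one]
  exact ENNReal.mul_lt_top ENNReal.coe_lt_top (edist_lt_top _ _)

end IsoElement

lemma exists_edge_length_bound : ∃ D : ℝ, 0 < D ∧ ∀ (s : RefCell) (a : Fin s.numVertices),
    dist (s.vertex a) (s.vertex (finRotate _ a)) ≤ D := by
  have h : ∀ s : RefCell, ∀ a, dist (s.vertex a) (s.vertex (finRotate _ a)) ≤
      ∑ a, dist (s.vertex a) (s.vertex (finRotate _ a)) := fun s a =>
    Finset.single_le_sum (f := fun a => dist (s.vertex a) (s.vertex (finRotate _ a)))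
      (fun _ _ => dist_nonneg) (Finset.mem_univ a)
  let L : RefCell → ℝ := fun s => ∑ a, dist (s.vertex a) (s.vertex (finRotate _ a))
  refine ⟨max 1 (max (L .triangle) (L .quadrilateral)), by positivity, fun s a => ?_⟩
  refine (h s a).trans ?_
  cases s
  · exact (le_max_left _ _).trans (le_max_right _ _)
  · exact (le_max_right _ _).trans (le_max_right _ _)

/-! ### Essentially bounded functions -/

section Bounded

variable {α : Type*} [MeasurableSpace α] {ν : Measure α}

lemma memLp_top_iff_bound {f : α → ℝ} :
    MemLp f ⊤ ν ↔ AEStronglyMeasurable f ν ∧ ∃ C : ℝ, ∀ᵐ x ∂ν, ‖f x‖ ≤ C := by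
  refine ⟨fun h => ⟨h.1, (eLpNorm f ⊤ ν).toReal, ?_⟩, fun h => ?_⟩
  · filter_upwards [ae_le_eLpNormEssSup (f := f) (μ := ν)] with x hx
    rw [← eLpNorm_exponent_top] at hx
    rw [← toReal_enorm]
    exact ENNReal.toReal_mono h.2.ne hx
  · obtain ⟨h1, C, hC⟩ := h
    exact memLp_top_of_bound h1 C hC

lemma memLp_top_mul {f g : α → ℝ} (hf : MemLp f ⊤ ν) (hg : MemLp g ⊤ ν) :
    MemLp (fun x => f x * g x) ⊤ ν := hg.mul hf

lemma memLp_top_pow_two {f : α → ℝ} (hf : MemLp f ⊤ ν) : MemLp (fun x => f x ^ 2) ⊤ ν := by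
  simpa only [pow_two] using memLp_top_mul hf hf

variable {m n p : ℕ}

lemma memLp_top_frobSq {A : α → Matrix (Fin m) (Fin n) ℝ}
    (hA : ∀ i j, MemLp (fun x => A x i j) ⊤ ν) : MemLp (fun x => frobSq (A x)) ⊤ ν :=
  memLp_finsetSum _ fun i _ => memLp_finsetSum _ fun j _ => memLp_top_pow_two (hA i j)

lemma memLp_top_matrix_mul {A : α → Matrix (Fin m) (Fin n) ℝ} {B : α → Matrix (Fin n) (Fin p) ℝ}
    (hA : ∀ i j, MemLp (fun x => A x i j) ⊤ ν) (hB : ∀ i j, MemLp (fun x => B x i j) ⊤ ν)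
    (i : Fin m) (j : Fin p) : MemLp (fun x => (A x * B x) i j) ⊤ ν := by
  simp only [Matrix.mul_apply]
  exact memLp_finsetSum _ fun k _ => memLp_top_mul (hA i k) (hB k j)

end Bounded

/-! ### Unit normals and edge diameters -/

lemma dotProduct_mulVec_sq_le (A : Matrix (Fin 2) (Fin 2) ℝ) (u v : Fin 2 → ℝ)
    (hu : u ⬝ᵥ u ≤ 1) : (A.mulVec u ⬝ᵥ v) ^ 2 ≤ frobSq A * (v ⬝ᵥ v) := by
  have h0 : ∀ w : Fin 2 → ℝ, w ⬝ᵥ w = ∑ i, w i ^ 2 := fun w => by simp [dotProduct, pow_two]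
  have h1 : (A.mulVec u ⬝ᵥ v) ^ 2 ≤ (∑ i, A.mulVec u i ^ 2) * ∑ i, v i ^ 2 :=
    Finset.sum_mul_sq_le_sq_mul_sq _ _ _
  have h2 : ∑ i, A.mulVec u i ^ 2 ≤ frobSq A * (u ⬝ᵥ u) := by
    rw [h0, frobSq, Finset.sum_mul]
    exact Finset.sum_le_sum fun i _ =>
      Finset.sum_mul_sq_le_sq_mul_sq Finset.univ (fun j => A i j) u
  rw [h0 v]
  refine h1.trans (mul_le_mul_of_nonneg_right ?_ (Finset.sum_nonneg fun _ _ => sq_nonneg _))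
  exact h2.trans (mul_le_of_le_one_right (frobSq_nonneg A) hu)

lemma dotProduct_self_nonneg' (v : Fin 2 → ℝ) : 0 ≤ v ⬝ᵥ v :=
  Finset.sum_nonneg fun _ _ => mul_self_nonneg _

/-- Cauchy–Schwarz needs only this upper bound, which also holds for `w = 0`, where the inverse is
`0`. -/
lemma IsoElement.unitNormal_dotProduct_le {k : ℕ} (T : IsoElement k)
    (a : Fin T.ref.numVertices) (x : Plane) : T.unitNormal a x ⬝ᵥ T.unitNormal a x ≤ 1 := by
  simp only [IsoElement.unitNormal]
  set w := ((T.jacobian (T.inv x))⁻¹).transpose.mulVec (T.ref.normal a)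
  have hw := dotProduct_self_nonneg' w
  rw [smul_dotProduct, dotProduct_smul, smul_eq_mul, smul_eq_mul, ← mul_assoc, ← mul_inv,
    Real.mul_self_sqrt hw]
  exact inv_mul_le_one

lemma RefCell.vertex_injective (s : RefCell) : Function.Injective s.vertex := by
  intro a b h
  have h0 := congrArg (fun x : Plane => x 0) h
  have h1 := congrArg (fun x : Plane => x 1) h
  cases s
  · change Fin 3 at a b
    fin_cases a <;> fin_cases b <;> first | rfl | (exfalso; simp [vertex] at h0 h1)
  · change Fin 4 at a b
    fin_cases a <;> fin_cases b <;> first | rfl | (exfalso; simp [vertex] at h0 h1)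

lemma RefCell.vertex_ne (s : RefCell) (a : Fin s.numVertices) :
    s.vertex a ≠ s.vertex (finRotate _ a) := by
  refine s.vertex_injective.ne ?_
  cases s
  · exact (by decide : ∀ a : Fin 3, a ≠ finRotate 3 a) a
  · exact (by decide : ∀ a : Fin 4, a ≠ finRotate 4 a) a

lemma IsoElement.diam_edge_pos {k : ℕ} (T : IsoElement k) (a : Fin T.ref.numVertices) :
    0 < Metric.diam (T.edge a) := by
  have hne : T.vertex a ≠ T.map (T.ref.vertex (finRotate _ a)) := fun h =>
    T.ref.vertex_ne a (T.injOn_map (T.ref.vertex_mem_cell _) (T.ref.vertex_mem_cell _) h)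
  exact (dist_pos.2 hne).trans_le (Metric.dist_le_diam_of_mem (T.isCompact_edge a).isBounded
    ⟨_, left_mem_segment ℝ _ _, rfl⟩ ⟨_, right_mem_segment ℝ _ _, rfl⟩)

lemma IsoElement.diam_edge_le {k : ℕ} (T : IsoElement k) (a : Fin T.ref.numVertices) :
    Metric.diam (T.edge a) ≤ T.diam :=
  Metric.diam_mono (T.edge_subset_carrier a) T.isCompact_carrier.isBounded

/-! ### Bounded fields on a mesh and bounded overlap of patches -/

namespace IsoMesh

variable {k : ℕ} {Ω : Set Plane} (M : IsoMesh k Ω)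

variable {M} in
lemma smoothUpTo_of_mem_femSpace {v : Plane → ℝ} (hv : v ∈ M.femSpace) (i : Fin M.N) :
    (M.elem i).SmoothUpTo v := by
  obtain ⟨p, -, hp⟩ := hv.2 i
  exact (M.elem i).smoothUpTo_of_polyEval p fun z hz => hp z (interior_subset hz)

variable {M} in
lemma smoothUpTo_of_mem_brokenSpace {l : ℕ} {w : Plane → ℝ} (hw : w ∈ M.brokenSpace l)
    (i : Fin M.N) : (M.elem i).SmoothUpTo w := by
  obtain ⟨p, -, hp⟩ := hw i
  exact (M.elem i).smoothUpTo_of_polyEval p hp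

variable {M} in
-- Finitely many elements cover `Ω`. The bound obtained may depend on the mesh; it serves only for
-- integrability.
lemma memLp_top_of_smoothUpTo {w : Plane → ℝ} (h : ∀ i, (M.elem i).SmoothUpTo w) :
    MemLp w ⊤ (volume.restrict Ω) := by
  have hsub : Ω ⊆ ⋃ i, (M.elem i).carrier := by rw [M.cover]; exact subset_closure
  refine MemLp.mono_measure (Measure.restrict_mono_set _ hsub) ?_
  rw [memLp_top_iff_bound]
  have h' := fun i => memLp_top_iff_bound.1 (h i).memLp_top
  refine ⟨aestronglyMeasurable_iUnion_iff.2 fun i => (h' i).1, ?_⟩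
  choose C hC using fun i => (h' i).2
  refine ⟨∑ i, |C i|, ?_⟩
  rw [ae_restrict_iUnion_iff]
  intro i
  filter_upwards [hC i] with x hx
  exact (hx.trans (le_abs_self _)).trans
    (Finset.single_le_sum (f := fun i => |C i|) (fun _ _ => abs_nonneg _) (Finset.mem_univ i))

lemma volume_inter_carrier {i j : Fin M.N} (hij : i ≠ j) :
    volume ((M.elem i).carrier ∩ (M.elem j).carrier) = 0 := by
  rcases M.conforming i j hij with h | ⟨a, b, h, -⟩ | ⟨a, b, h, -⟩
  · rw [h, measure_empty]
  · rw [h, measure_singleton]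
  · rw [h]; exact (M.elem i).volume_edge a

/-- Almost every point of `Ω` lies in exactly one element. -/
lemma ae_existsUnique_carrier : ∀ᵐ x ∂(volume.restrict Ω),
    ∃ m, x ∈ (M.elem m).carrier ∧ ∀ i, x ∈ (M.elem i).carrier → i = m := by
  have h1 : ∀ᵐ x ∂(volume.restrict Ω), x ∈ closure Ω := by
    refine ae_mono (Measure.restrict_mono_set volume subset_closure) ?_
    exact ae_restrict_mem isClosed_closure.measurableSet
  have h2 : ∀ᵐ x ∂(volume.restrict Ω), ∀ i j, i ≠ j →
      x ∉ (M.elem i).carrier ∩ (M.elem j).carrier := by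
    refine ae_restrict_of_ae ?_
    rw [ae_all_iff]; intro i
    rw [ae_all_iff]; intro j
    by_cases hij : i = j
    · exact ae_of_all _ fun x h => absurd hij h
    · filter_upwards [measure_eq_zero_iff_ae_notMem.1 (M.volume_inter_carrier hij)] with x hx _
      exact hx
  filter_upwards [h1, h2] with x hx hx2
  rw [← M.cover, Set.mem_iUnion] at hx
  obtain ⟨m, hm⟩ := hx
  exact ⟨m, hm, fun i hi => by_contra fun hne => hx2 i m hne ⟨hi, hm⟩⟩

/-- Shape regularity and quasi-uniformity of one mesh, with constants. -/
structure Regular (σ τ : ℝ) : Prop where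
  one_le_shape : 1 ≤ σ
  one_le_quasi : 1 ≤ τ
  shape : ∀ i, (M.elem i).ShapeBound σ
  quasi : ∀ i j, (M.elem i).diam ≤ τ * (M.elem j).diam

open Classical in
/-- The elements that meet a given element. -/
def neighbours (i : Fin M.N) : Finset (Fin M.N) :=
  Finset.univ.filter fun j => ((M.elem i).carrier ∩ (M.elem j).carrier).Nonempty

variable {M}

/-- Area packing: all neighbours lie in a ball of radius `(1 + τ) d`, overlap only in null sets, and
each has area at least `d² v / (τ² σ²)`. The powers of `d` cancel. -/
lemma Regular.card_neighbours_le {σ τ : ℝ} (h : M.Regular σ τ) (i : Fin M.N) :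
    ((M.neighbours i).card : ℝ) ≤
      Real.pi * (1 + τ) ^ 2 * (τ ^ 2 * σ ^ 2) / volume.real RefCell.triangle.cell := by
  have hσ : 0 < σ := zero_lt_one.trans_le h.one_le_shape
  have hτ : 0 < τ := zero_lt_one.trans_le h.one_le_quasi
  set d := (M.elem i).diam with hd
  have hd0 : 0 < d := (M.elem i).diam_pos
  set v := volume.real RefCell.triangle.cell with hv
  have hv0 : 0 < v := by
    refine ENNReal.toReal_pos ?_ (RefCell.isCompact_cell _).measure_lt_top.ne
    exact ((isOpen_interior.measure_pos volume (RefCell.nonempty_interior_cell _)).trans_le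
      (measure_mono interior_subset)).ne'
  obtain ⟨z, hz⟩ := (M.elem i).ref.nonempty_interior_cell
  set x₀ := (M.elem i).map z
  have hx₀ : x₀ ∈ (M.elem i).carrier := ⟨z, interior_subset hz, rfl⟩
  have hsub : ∀ j ∈ M.neighbours i,
      (M.elem j).carrier ⊆ Metric.closedBall x₀ ((1 + τ) * d) := by
    intro j hj x hx
    have hj' : ((M.elem i).carrier ∩ (M.elem j).carrier).Nonempty := by
      simpa [neighbours] using hj
    obtain ⟨y, hyi, hyj⟩ := hj'
    have h1 : dist x y ≤ τ * d :=
      (Metric.dist_le_diam_of_mem (M.elem j).isCompact_carrier.isBounded hx hyj).trans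
        (h.quasi j i)
    have h2 : dist y x₀ ≤ d :=
      Metric.dist_le_diam_of_mem (M.elem i).isCompact_carrier.isBounded hyi hx₀
    rw [Metric.mem_closedBall]
    linarith [dist_triangle x y x₀]
  have hlow : ∀ j ∈ M.neighbours i, d ^ 2 / (τ ^ 2 * σ ^ 2) * v ≤
      volume.real (M.elem j).carrier := by
    intro j _
    refine le_trans ?_ ((h.shape j).volume_ge hσ)
    have h1 : v ≤ volume.real (M.elem j).ref.cell :=
      measureReal_mono (RefCell.triangle_cell_subset _)
        (RefCell.isCompact_cell _).measure_lt_top.ne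
    refine mul_le_mul ?_ h1 hv0.le (by positivity)
    rw [div_le_div_iff₀ (by positivity) (by positivity)]
    have := pow_le_pow_left₀ hd0.le (h.quasi i j) 2
    nlinarith [sq_nonneg σ]
  have hsum : ∑ j ∈ M.neighbours i, volume.real (M.elem j).carrier ≤
      Real.pi * ((1 + τ) * d) ^ 2 := by
    have hball : volume.real (Metric.closedBall x₀ ((1 + τ) * d)) =
        Real.pi * ((1 + τ) * d) ^ 2 := by
      rw [Measure.real, EuclideanSpace.volume_closedBall_fin_two, ENNReal.toReal_mul,
        ENNReal.toReal_pow, ENNReal.toReal_ofReal (by positivity),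
        ENNReal.toReal_ofReal Real.pi_pos.le, mul_comm]
    rw [← hball, ← measureReal_biUnion_finset₀ (h := fun j _ =>
      (M.elem j).isCompact_carrier.measure_lt_top.ne)]
    · exact measureReal_mono (Set.iUnion₂_subset hsub) measure_closedBall_lt_top.ne
    · intro a _ b _ hab
      exact M.volume_inter_carrier hab
    · exact fun j _ => (M.elem j).isCompact_carrier.measurableSet.nullMeasurableSet
  have hcard : ((M.neighbours i).card : ℝ) * (d ^ 2 / (τ ^ 2 * σ ^ 2) * v) ≤
      Real.pi * ((1 + τ) * d) ^ 2 := by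
    rw [← nsmul_eq_mul]
    exact (Finset.card_nsmul_le_sum _ _ _ hlow).trans hsum
  rw [le_div_iff₀ hv0]
  have e : ((M.neighbours i).card : ℝ) * v = ((M.neighbours i).card : ℝ) *
      (d ^ 2 / (τ ^ 2 * σ ^ 2) * v) * ((τ ^ 2 * σ ^ 2) / d ^ 2) := by field_simp
  rw [e]
  refine (mul_le_mul_of_nonneg_right hcard (by positivity)).trans (le_of_eq ?_)
  field_simp

lemma mem_interiorEdges {e : M.EdgeIndex} : e ∈ M.interiorEdges ↔ e.1 < e.2.1 ∧
    (M.minus e).carrier ∩ (M.plus e).carrier = M.edgeSet e ∧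
    (∃ b, M.edgeSet e = (M.plus e).edge b) ∧ M.openEdgeSet e ⊆ Ω := by
  simp [interiorEdges]

lemma edgeSet_subset {e : M.EdgeIndex} (he : e ∈ M.interiorEdges) :
    M.edgeSet e ⊆ (M.minus e).carrier ∧ M.edgeSet e ⊆ (M.plus e).carrier := by
  have h := (mem_interiorEdges.1 he).2.1
  exact ⟨h ▸ Set.inter_subset_left, h ▸ Set.inter_subset_right⟩

open Classical in
/-- The number of edges whose two elements cover a point that lies in one element only. -/
lemma Regular.card_edges_le {σ τ : ℝ} (h : M.Regular σ τ) {s : Finset M.EdgeIndex}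
    (hs : s ⊆ M.interiorEdges) {x : Plane} {m : Fin M.N} (hm : ∀ i, x ∈ (M.elem i).carrier → i = m)
    (hx : ∀ e ∈ s, x ∈ (M.minus e).carrier ∪ (M.plus e).carrier) :
    (s.card : ℝ) ≤ 4 * (Real.pi * (1 + τ) ^ 2 * (τ ^ 2 * σ ^ 2) /
      volume.real RefCell.triangle.cell) ^ 2 := by
  have hnv : ∀ c : RefCell, c.numVertices ≤ 4 := fun c => by cases c <;> simp [RefCell.numVertices]
  -- One of the two elements of such an edge contains `x`, hence is the `m`-th, and the other shares
  -- the edge with it. Both are neighbours of `m`, which counts among its own neighbours.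
  have hsub : s ⊆ (M.neighbours m).sigma fun i => (M.neighbours m) ×ˢ Finset.univ := by
    intro e he
    have hne : (M.edgeSet e).Nonempty := ⟨_, _, left_mem_segment ℝ _ _, rfl⟩
    obtain ⟨h1, h2⟩ := edgeSet_subset (hs he)
    have hn : ((M.minus e).carrier ∩ (M.plus e).carrier).Nonempty :=
      hne.mono (Set.subset_inter h1 h2)
    have hmin : (M.minus e).carrier.Nonempty := hne.mono h1
    have hplu : (M.plus e).carrier.Nonempty := hne.mono h2
    simp only [Finset.mem_sigma, Finset.mem_product, Finset.mem_univ, and_true, neighbours,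
      Finset.mem_filter, true_and]
    rcases hx e he with hx | hx
    · rw [← hm _ hx]
      exact ⟨by rw [Set.inter_self]; exact hmin, hn⟩
    · rw [← hm _ hx]
      exact ⟨by rw [Set.inter_comm]; exact hn, by rw [Set.inter_self]; exact hplu⟩
  have hc : s.card ≤ (M.neighbours m).card * ((M.neighbours m).card * 4) := by
    refine (Finset.card_le_card hsub).trans ?_
    rw [Finset.card_sigma]
    refine Finset.sum_le_card_nsmul _ _ _ fun i _ => ?_
    rw [Finset.card_product, Finset.card_univ, Fintype.card_fin]
    exact Nat.mul_le_mul_left _ (hnv _)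
  have hb := h.card_neighbours_le m
  calc (s.card : ℝ) ≤ (M.neighbours m).card * ((M.neighbours m).card * 4) := by exact_mod_cast hc
    _ = 4 * ((M.neighbours m).card : ℝ) ^ 2 := by ring
    _ ≤ _ := by gcongr

end IsoMesh

/-- Young's inequality with a free weight `t`, applied pointwise on an edge so that the lifting term
can be absorbed. -/
lemma abs_le_of_sq_le_mul {x a b t : ℝ} (ht : 0 < t) (ha : 0 ≤ a) (hb : 0 ≤ b)
    (h : x ^ 2 ≤ a * b) : |x| ≤ (t * a + t⁻¹ * b) / 2 := by
  refine abs_le_of_sq_le_sq (h.trans ?_) (by positivity)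
  have e : a * b = (t * a) * (t⁻¹ * b) := by field_simp
  rw [e]
  nlinarith [sq_nonneg (t * a - t⁻¹ * b)]

/-! ### Stability of the liftings -/

namespace IsoMesh

variable {k : ℕ} {Ω : Set Plane} {M : IsoMesh k Ω}

lemma continuousOn_jumpGrad {v : Plane → ℝ} (hv : v ∈ M.femSpace) {e : M.EdgeIndex}
    (he : e ∈ M.interiorEdges) (j : Fin 2) :
    ContinuousOn (fun x => M.jumpGrad e v x j) (M.edgeSet e) := by
  obtain ⟨h1, h2⟩ := edgeSet_subset he
  exact (((smoothUpTo_of_mem_femSpace hv e.1).grad j).exists_trace.1.mono h1).sub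
    (((smoothUpTo_of_mem_femSpace hv e.2.1).grad j).exists_trace.1.mono h2)

lemma isCompact_edgeSet (e : M.EdgeIndex) : IsCompact (M.edgeSet e) :=
  (M.elem e.1).isCompact_edge e.2.2

lemma integrableOn_edgeSet {e : M.EdgeIndex} {f : Plane → ℝ} (hf : ContinuousOn f (M.edgeSet e)) :
    IntegrableOn f (M.edgeSet e) (Measure.hausdorffMeasure 1) := by
  have hc := M.isCompact_edgeSet e
  obtain ⟨C, hC⟩ := hc.exists_bound_of_continuousOn hf
  have hlt : Measure.hausdorffMeasure 1 (M.edgeSet e) < ⊤ :=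
    (M.elem e.1).hausdorffMeasure_edge_lt_top e.2.2
  exact ⟨hf.aestronglyMeasurable hc.measurableSet, HasFiniteIntegral.restrict_of_bounded C hlt
    ((ae_restrict_iff' hc.measurableSet).2 (ae_of_all _ hC))⟩

lemma continuousOn_dotProduct_self {e : M.EdgeIndex} {φ : Plane → Fin 2 → ℝ}
    (hφ : ∀ j, ContinuousOn (fun x => φ x j) (M.edgeSet e)) :
    ContinuousOn (fun x => φ x ⬝ᵥ φ x) (M.edgeSet e) := by
  simp only [dotProduct, Fin.sum_univ_two]
  exact ((hφ 0).mul (hφ 0)).add ((hφ 1).mul (hφ 1))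

/-- The inverse estimates on both reference cells hold with the constant `C`. -/
def InverseConst (l : ℕ) (C : ℝ) : Prop :=
  0 < C ∧ ∀ (s : RefCell), ∀ p ∈ s.polySpace l, ∀ z ∈ s.cell,
    polyEval p z ^ 2 ≤ C * ∫ x in s.cell, polyEval p x ^ 2

lemma exists_inverseConst (l : ℕ) : ∃ C, InverseConst l C := by
  obtain ⟨C₁, h₁, H₁⟩ := RefCell.triangle.exists_inverse_estimate l
  obtain ⟨C₂, h₂, H₂⟩ := RefCell.quadrilateral.exists_inverse_estimate l
  refine ⟨C₁ + C₂, by positivity, fun s p hp z hz => ?_⟩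
  have h0 : 0 ≤ ∫ x in s.cell, polyEval p x ^ 2 := integral_nonneg fun _ => sq_nonneg _
  cases s
  · exact (H₁ p hp z hz).trans (mul_le_mul_of_nonneg_right (by linarith) h0)
  · exact (H₂ p hp z hz).trans (mul_le_mul_of_nonneg_right (by linarith) h0)

lemma Regular.traceFrom_sq_le {σ τ : ℝ} (h : M.Regular σ τ) {l : ℕ} {C : ℝ}
    (hC : InverseConst l C) {w : Plane → ℝ} (hw : w ∈ M.brokenSpace l) (i : Fin M.N) {x : Plane}
    (hx : x ∈ (M.elem i).carrier) :
    traceFrom (M.elem i).openCell w x ^ 2 ≤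
      C * σ ^ 2 * ((M.elem i).diam ^ 2)⁻¹ * ∫ x in (M.elem i).carrier, w x ^ 2 := by
  have hσ : 0 < σ := zero_lt_one.trans_le h.one_le_shape
  obtain ⟨p, hp, hpw⟩ := hw i
  obtain ⟨z, hz, rfl⟩ := hx
  rw [IsoElement.traceFrom_map hpw hz]
  exact (h.shape i).inverse_estimate hσ hC.1 (hC.2 _ p hp) hpw z hz

/-- The local lifting is bounded by the weighted `L²` norm on the edge. -/
lemma Regular.integral_lifting_le {σ τ : ℝ} (h : M.Regular σ τ) {l : ℕ} {C : ℝ}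
    (hC : InverseConst l C) {D : ℝ} (hD0 : 0 < D) (hD : ∀ (s : RefCell) (a : Fin s.numVertices),
      dist (s.vertex a) (s.vertex (finRotate _ a)) ≤ D) {e : M.EdgeIndex}
    (he : e ∈ M.interiorEdges) {φ : Plane → Fin 2 → ℝ}
    (hφ : ∀ j, ContinuousOn (fun x => φ x j) (M.edgeSet e)) {r : Plane → Matrix (Fin 2) (Fin 2) ℝ}
    (hr : M.IsLocalLifting l e φ r) :
    ∫ x in (M.minus e).carrier ∪ (M.plus e).carrier, frobSq (r x) ≤
      16 * (C * σ ^ 3 * τ ^ 2 * D) *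
        ∫ x in M.edgeSet e, (M.edgeDiam e)⁻¹ * (φ x ⬝ᵥ φ x) ∂(Measure.hausdorffMeasure 1) := by
  have hσ : 0 < σ := zero_lt_one.trans_le h.one_le_shape
  have hτ : 0 < τ := zero_lt_one.trans_le h.one_le_quasi
  have hC0 := hC.1
  obtain ⟨hbr, -, htest⟩ := hr
  set ω := (M.minus e).carrier ∪ (M.plus e).carrier with hω
  set I := ∫ x in ω, frobSq (r x) with hI
  have hI0 : 0 ≤ I := integral_nonneg fun _ => frobSq_nonneg _
  set d := (M.minus e).diam with hd
  have hd0 : 0 < d := (M.minus e).diam_pos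
  have hint : IntegrableOn (fun x => frobSq (r x)) ω := by
    have hi : ∀ i, IntegrableOn (fun x => frobSq (r x)) (M.elem i).carrier := fun i => by
      have : IsFiniteMeasure (volume.restrict (M.elem i).carrier) :=
        ⟨by simpa using (M.elem i).isCompact_carrier.measure_lt_top⟩
      exact (memLp_top_frobSq fun a b =>
        (smoothUpTo_of_mem_brokenSpace (hbr a b) i).memLp_top).integrable le_top
    exact (hi e.1).union (hi e.2.1)
  have hcell : ∀ i, (M.elem i).carrier ⊆ ω → ∀ a b,
      ∫ x in (M.elem i).carrier, r x a b ^ 2 ≤ I := fun i hi a b => by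
    have h1 : ∫ x in (M.elem i).carrier, r x a b ^ 2 ≤
        ∫ x in (M.elem i).carrier, frobSq (r x) := by
      refine integral_mono_of_nonneg (ae_of_all _ fun _ => sq_nonneg _) (hint.mono_set hi)
        (ae_of_all _ fun x => sq_entry_le_frobSq (r x) a b)
    exact h1.trans (setIntegral_mono_set hint (ae_of_all _ fun _ => frobSq_nonneg _)
      hi.eventuallyLE)
  -- Common bound for the squared entries of both traces: quasi-uniformity replaces both element
  -- diameters by `d`, the diameter of `T⁻`.
  set B := C * σ ^ 2 * τ ^ 2 * (d ^ 2)⁻¹ * I with hB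
  have hB0 : 0 ≤ B := by positivity
  have htrace : ∀ i, (M.elem i).carrier ⊆ ω → ∀ a b, ∀ x ∈ (M.elem i).carrier,
      traceFrom (M.elem i).openCell (fun z => r z a b) x ^ 2 ≤ B := fun i hi a b x hx => by
    have hdi := (M.elem i).diam_pos
    refine (h.traceFrom_sq_le hC (hbr a b) i hx).trans ?_
    have h1 : ((M.elem i).diam ^ 2)⁻¹ ≤ τ ^ 2 * (d ^ 2)⁻¹ := by
      have h2 := pow_le_pow_left₀ hd0.le (h.quasi e.1 i) 2
      rw [inv_le_iff_one_le_mul₀ (by positivity), mul_comm, ← mul_assoc, ← div_eq_mul_inv,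
        le_div_iff₀ (by positivity), one_mul]
      nlinarith
    calc C * σ ^ 2 * ((M.elem i).diam ^ 2)⁻¹ * ∫ x in (M.elem i).carrier, r x a b ^ 2
        ≤ C * σ ^ 2 * (τ ^ 2 * (d ^ 2)⁻¹) * I := by
          refine mul_le_mul (mul_le_mul_of_nonneg_left h1 (by positivity)) (hcell i hi a b)
            (integral_nonneg fun _ => sq_nonneg _) (by positivity)
      _ = B := by rw [hB]; ring
  obtain ⟨hs1, hs2⟩ := edgeSet_subset he
  have havg : ∀ x ∈ M.edgeSet e, frobSq (M.avgMatrix e r x) ≤ 4 * B := fun x hx => by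
    have : ∀ a b, M.avgMatrix e r x a b ^ 2 ≤ B := fun a b => by
      have h1 := htrace e.1 Set.subset_union_left a b x (hs1 hx)
      have h2 := htrace e.2.1 Set.subset_union_right a b x (hs2 hx)
      change ((_ + _) / 2) ^ 2 ≤ B
      change traceFrom (M.minus e).openCell _ x ^ 2 ≤ B at h1
      change traceFrom (M.plus e).openCell _ x ^ 2 ≤ B at h2
      nlinarith [sq_nonneg (traceFrom (M.minus e).openCell (fun z => r z a b) x -
        traceFrom (M.plus e).openCell (fun z => r z a b) x)]
    simp only [frobSq, Fin.sum_univ_two]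
    linarith [this 0 0, this 0 1, this 1 0, this 1 1]
  set Q := C * σ ^ 3 * τ ^ 2 * D with hQ
  have hQ0 : 0 < Q := by positivity
  -- The weight for which the first Young term, integrated over an edge of length at most `σ D d`,
  -- is at most `I / 2`. What remains yields `I ≤ 4 Q d⁻¹ P`, so the stated factor 16 leaves room.
  set t := d / (4 * Q) with ht
  have ht0 : 0 < t := by positivity
  have hmeas := (M.isCompact_edgeSet e).measurableSet
  have hφi := integrableOn_edgeSet (continuousOn_dotProduct_self hφ)
  have hconst : IntegrableOn (fun _ => (t * (4 * B) / 2 : ℝ)) (M.edgeSet e)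
      (Measure.hausdorffMeasure 1) := integrableOn_edgeSet continuousOn_const
  set P := ∫ x in M.edgeSet e, φ x ⬝ᵥ φ x ∂(Measure.hausdorffMeasure 1) with hP
  have hP0 : 0 ≤ P := integral_nonneg fun x => dotProduct_self_nonneg' _
  have key : I ≤ (Measure.hausdorffMeasure 1).real (M.edgeSet e) * (t * (4 * B) / 2) +
      t⁻¹ / 2 * P := by
    -- The lifting is its own test function.
    have h1 : I = ∫ x in M.edgeSet e, (M.avgMatrix e r x).mulVec (M.edgeNormal e x) ⬝ᵥ φ x
        ∂(Measure.hausdorffMeasure 1) := by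
      rw [← htest r hbr]; simp only [frobInner_self, hI]
    have h2 := norm_integral_le_of_norm_le (μ := (Measure.hausdorffMeasure 1).restrict
        (M.edgeSet e)) (f := fun x => (M.avgMatrix e r x).mulVec (M.edgeNormal e x) ⬝ᵥ φ x)
      (hconst.add (hφi.const_mul (t⁻¹ / 2)))
      ((ae_restrict_iff' hmeas).2 (ae_of_all _ fun x hx => by
        have hn := dotProduct_mulVec_sq_le (M.avgMatrix e r x) (M.edgeNormal e x) (φ x)
          ((M.elem e.1).unitNormal_dotProduct_le e.2.2 x)
        have hle := abs_le_of_sq_le_mul ht0 (frobSq_nonneg _) (dotProduct_self_nonneg' (φ x)) hn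
        rw [Real.norm_eq_abs]
        refine hle.trans ?_
        have := mul_le_mul_of_nonneg_left (havg x hx) ht0.le
        simp only [Pi.add_apply]
        linarith))
    rw [← h1] at h2
    refine (le_abs_self I).trans (h2.trans (le_of_eq ?_))
    simp only [Pi.add_apply]
    rw [integral_add hconst (hφi.const_mul _), integral_const_mul, setIntegral_const, smul_eq_mul]
  have hH : (Measure.hausdorffMeasure 1).real (M.edgeSet e) ≤ σ * D * d :=
    ENNReal.toReal_le_of_le_ofReal (by positivity)
      ((h.shape e.1).hausdorffMeasure_edge_le hσ e.2.2 (hD _ _))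
  have h3 : (Measure.hausdorffMeasure 1).real (M.edgeSet e) * (t * (4 * B) / 2) ≤ I / 2 := by
    refine (mul_le_mul_of_nonneg_right hH (by positivity)).trans (le_of_eq ?_)
    rw [ht, hB, hQ]
    field_simp
  have h4 : t⁻¹ / 2 * P = 2 * Q * (d⁻¹ * P) := by
    rw [ht]; field_simp; ring
  -- An edge is no longer in diameter than its element, so the weight `h_e⁻¹` dominates `h_T⁻¹`.
  have h5 : d⁻¹ * P ≤ (M.edgeDiam e)⁻¹ * P :=
    mul_le_mul_of_nonneg_right (inv_anti₀ ((M.elem e.1).diam_edge_pos e.2.2)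
      ((M.elem e.1).diam_edge_le e.2.2)) hP0
  have h6 : 0 ≤ (M.edgeDiam e)⁻¹ * P := mul_nonneg (inv_nonneg.2 Metric.diam_nonneg) hP0
  rw [integral_const_mul]
  nlinarith [mul_le_mul_of_nonneg_left h5 hQ0.le, mul_nonneg hQ0.le h6]

lemma jumpNormSq_nonneg (crease : Set Plane) (v : Plane → ℝ) : 0 ≤ M.jumpNormSq crease v :=
  Finset.sum_nonneg fun _ _ => integral_nonneg fun _ =>
    mul_nonneg (inv_nonneg.2 Metric.diam_nonneg) (dotProduct_self_nonneg' _)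

/-- True also for the default value `0`, so boundedness of the liftings does not depend on the
existence of a solution. -/
lemma localLifting_entry_mem (l : ℕ) (e : M.EdgeIndex) (φ : Plane → Fin 2 → ℝ) :
    M.localLifting l e φ ∈ M.brokenMatrixSpace l := by
  unfold localLifting
  split_ifs with h
  · exact h.choose_spec.1
  · exact fun a b i => ⟨0, Submodule.zero_mem _, fun z _ => by simp [polyEval]⟩

lemma localLifting_eq_zero (l : ℕ) (e : M.EdgeIndex) (φ : Plane → Fin 2 → ℝ) {x : Plane}
    (hx : x ∉ (M.minus e).carrier ∪ (M.plus e).carrier) : M.localLifting l e φ x = 0 := by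
  unfold localLifting
  split_ifs with h
  · exact h.choose_spec.2.1 x hx
  · rfl

lemma memLp_localLifting (l : ℕ) (e : M.EdgeIndex) (φ : Plane → Fin 2 → ℝ) (a b : Fin 2) :
    MemLp (fun x => M.localLifting l e φ x a b) ⊤ (volume.restrict Ω) :=
  memLp_top_of_smoothUpTo fun i => smoothUpTo_of_mem_brokenSpace (localLifting_entry_mem l e φ a b) i

lemma memLp_brokenHessian {v : Plane → ℝ} (hv : v ∈ M.femSpace) (a b : Fin 2) :
    MemLp (fun x => brokenHessian v x a b) ⊤ (volume.restrict Ω) :=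
  memLp_top_of_smoothUpTo fun i => ((smoothUpTo_of_mem_femSpace hv i).grad b).grad a

lemma freeEdges_subset (crease : Set Plane) : M.freeEdges crease ⊆ M.interiorEdges :=
  fun _ he => by
    classical
    simp only [freeEdges, Finset.mem_filter] at he
    exact he.1

/-- `L²` stability of the sum of the liftings, uniformly over regular meshes. -/
lemma exists_lifting_stability (l : ℕ) (σ τ : ℝ) (hσ : 1 ≤ σ) (hτ : 1 ≤ τ) :
    ∃ K : ℝ, 0 < K ∧ ∀ {k : ℕ} {Ω : Set Plane} (M : IsoMesh k Ω), Bornology.IsBounded Ω →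
      M.Regular σ τ → ∀ (crease : Set Plane), ∀ v ∈ M.femSpace,
      ∫ x in Ω, frobSq (∑ e ∈ M.freeEdges crease, M.localLifting l e (M.jumpGrad e v) x) ≤
        K * M.jumpNormSq crease v := by
  classical
  obtain ⟨C, hC⟩ := exists_inverseConst l
  obtain ⟨D, hD0, hD⟩ := exists_edge_length_bound
  have hC0 := hC.1
  set ν := 4 * (Real.pi * (1 + τ) ^ 2 * (τ ^ 2 * σ ^ 2) /
    volume.real RefCell.triangle.cell) ^ 2 with hν
  have hν0 : 0 ≤ ν := by positivity
  -- `ν + 1` instead of `ν` makes the constant positive when only `0 ≤ ν` is at hand.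
  refine ⟨(ν + 1) * (16 * (C * σ ^ 3 * τ ^ 2 * D)), by positivity,
    fun {k Ω} M hΩ h crease v hv => ?_⟩
  have : IsFiniteMeasure (volume.restrict Ω) := ⟨by simpa using hΩ.measure_lt_top⟩
  set r := fun e x => M.localLifting l e (M.jumpGrad e v) x with hr
  have hint : ∀ e, IntegrableOn (fun x => frobSq (r e x)) Ω := fun e =>
    (memLp_top_frobSq fun a b => memLp_localLifting l e _ a b).integrable le_top
  -- At almost every point only the liftings whose patch contains it are nonzero. There are at most
  -- `ν` of them, so Cauchy–Schwarz for the sum costs `ν` and not the number of all edges.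
  have hpt : ∀ᵐ x ∂(volume.restrict Ω), frobSq (∑ e ∈ M.freeEdges crease, r e x) ≤
      ν * ∑ e ∈ M.freeEdges crease, frobSq (r e x) := by
    filter_upwards [M.ae_existsUnique_carrier] with x hx
    obtain ⟨m, -, hm⟩ := hx
    set s := (M.freeEdges crease).filter fun e =>
      x ∈ (M.minus e).carrier ∪ (M.plus e).carrier with hs
    have hsum : ∑ e ∈ M.freeEdges crease, r e x = ∑ e ∈ s, r e x := by
      rw [hs, Finset.sum_filter]
      refine Finset.sum_congr rfl fun e _ => ?_
      split_ifs with hxe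
      · rfl
      · exact localLifting_eq_zero l e _ hxe
    have hcard := h.card_edges_le ((Finset.filter_subset _ _).trans (freeEdges_subset crease) :
      s ⊆ M.interiorEdges) hm fun e he => (Finset.mem_filter.1 he).2
    rw [hsum]
    refine (frobSq_sum_le s _).trans ?_
    refine mul_le_mul hcard ?_ (Finset.sum_nonneg fun _ _ => frobSq_nonneg _) hν0
    exact Finset.sum_le_sum_of_subset_of_nonneg (Finset.filter_subset _ _)
      fun _ _ _ => frobSq_nonneg _
  have hedge : ∀ e ∈ M.freeEdges crease, ∫ x in Ω, frobSq (r e x) ≤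
      16 * (C * σ ^ 3 * τ ^ 2 * D) * ∫ x in M.edgeSet e, (M.edgeDiam e)⁻¹ *
        (M.jumpGrad e v x ⬝ᵥ M.jumpGrad e v x) ∂(Measure.hausdorffMeasure 1) := by
    intro e he
    have he' := freeEdges_subset crease he
    by_cases hex : ∃ r, M.IsLocalLifting l e (M.jumpGrad e v) r
    · have hlift : M.IsLocalLifting l e (M.jumpGrad e v) (r e) := by
        have : r e = hex.choose := by simp only [hr, localLifting, dif_pos hex]
        rw [this]; exact hex.choose_spec
      refine le_trans ?_ (h.integral_lifting_le hC hD0 hD he'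
        (continuousOn_jumpGrad hv he') hlift)
      set ω := (M.minus e).carrier ∪ (M.plus e).carrier with hω
      have hωc : IsCompact ω := (M.minus e).isCompact_carrier.union (M.plus e).isCompact_carrier
      have hωint : IntegrableOn (fun x => frobSq (r e x)) ω := by
        have hi : ∀ i, IntegrableOn (fun x => frobSq (r e x)) (M.elem i).carrier := fun i => by
          have : IsFiniteMeasure (volume.restrict (M.elem i).carrier) :=
            ⟨by simpa using (M.elem i).isCompact_carrier.measure_lt_top⟩
          exact (memLp_top_frobSq fun a b =>
            (smoothUpTo_of_mem_brokenSpace (hlift.1 a b) i).memLp_top).integrable le_top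
        exact (hi e.1).union (hi e.2.1)
      have hind : (fun x => frobSq (r e x)) = ω.indicator fun x => frobSq (r e x) := by
        ext x
        by_cases hx : x ∈ ω
        · rw [Set.indicator_of_mem hx]
        · rw [Set.indicator_of_notMem hx, hlift.2.1 x hx]; simp [frobSq]
      rw [hind, setIntegral_indicator hωc.measurableSet, ← hind]
      exact setIntegral_mono_set hωint (ae_of_all _ fun _ => frobSq_nonneg _)
        Set.inter_subset_right.eventuallyLE
    -- Without a solution of the lifting problem the definition returns `0`, and the bound is
    -- trivial.
    · have h0 : ∀ x, r e x = 0 := fun x => by simp only [hr, localLifting, dif_neg hex]; rfl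
      have : ∀ x, frobSq (r e x) = 0 := fun x => by rw [h0]; simp [frobSq]
      simp only [this, integral_zero]
      refine mul_nonneg (by positivity) (integral_nonneg fun _ => ?_)
      exact mul_nonneg (inv_nonneg.2 Metric.diam_nonneg) (dotProduct_self_nonneg' _)
  have hsumint : IntegrableOn (fun x => ∑ e ∈ M.freeEdges crease, frobSq (r e x)) Ω :=
    integrable_finsetSum _ fun e _ => hint e
  have hJ := M.jumpNormSq_nonneg crease v
  calc ∫ x in Ω, frobSq (∑ e ∈ M.freeEdges crease, r e x)
      ≤ ∫ x in Ω, ν * ∑ e ∈ M.freeEdges crease, frobSq (r e x) :=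
        integral_mono_of_nonneg (ae_of_all _ fun _ => frobSq_nonneg _) (hsumint.const_mul ν) hpt
    _ = ν * ∑ e ∈ M.freeEdges crease, ∫ x in Ω, frobSq (r e x) := by
        rw [integral_const_mul, integral_finsetSum _ fun e _ => hint e]
    _ ≤ ν * (16 * (C * σ ^ 3 * τ ^ 2 * D) * M.jumpNormSq crease v) := by
        rw [jumpNormSq, Finset.mul_sum (M.freeEdges crease) _ (16 * (C * σ ^ 3 * τ ^ 2 * D))]
        exact mul_le_mul_of_nonneg_left (Finset.sum_le_sum hedge) hν0
    _ ≤ (ν + 1) * (16 * (C * σ ^ 3 * τ ^ 2 * D)) * M.jumpNormSq crease v := by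
        rw [← mul_assoc]
        exact mul_le_mul_of_nonneg_right
          (mul_le_mul_of_nonneg_right (by linarith) (by positivity)) hJ

end IsoMesh

/-! ### Target metrics -/

section Metric

variable {Ω : Set Plane} {g : Plane → Matrix (Fin 2) (Fin 2) ℝ}

lemma IsTargetMetric.memLp_entry (hg : IsTargetMetric Ω g) (a b : Fin 2) :
    MemLp (fun x => g x a b) ⊤ (volume.restrict Ω) := by
  obtain ⟨c, hc⟩ := hg.bounded
  refine memLp_top_of_bound (hg.aemeasurable a b).aestronglyMeasurable c ?_
  filter_upwards [hc] with x hx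
  exact (abs_entry_le_frobNorm _ a b).trans hx

lemma memLp_frobNorm {α : Type*} [MeasurableSpace α] {ν : Measure α} {m n : ℕ}
    {A : α → Matrix (Fin m) (Fin n) ℝ} (hA : ∀ i j, MemLp (fun x => A x i j) ⊤ ν) :
    MemLp (fun x => frobNorm (A x)) ⊤ ν := by
  obtain ⟨h1, C, hC⟩ := memLp_top_iff_bound.1 (memLp_top_frobSq hA)
  refine memLp_top_of_bound (Real.continuous_sqrt.comp_aestronglyMeasurable h1) √C ?_
  filter_upwards [hC] with x hx
  rw [Real.norm_of_nonneg (frobNorm_nonneg _)]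
  exact Real.sqrt_le_sqrt ((le_abs_self _).trans hx)

lemma IsTargetMetric.ae_frobNorm_le (hg : IsTargetMetric Ω g) :
    ∀ᵐ x ∂(volume.restrict Ω), frobNorm (g x) ≤ metricSup Ω g := by
  filter_upwards [ae_le_eLpNormEssSup (f := fun x => frobNorm (g x))
    (μ := volume.restrict Ω)] with x hx
  rw [← eLpNorm_exponent_top] at hx
  have := ENNReal.toReal_mono (memLp_frobNorm hg.memLp_entry).2.ne hx
  rwa [toReal_enorm, Real.norm_of_nonneg (frobNorm_nonneg _)] at this

lemma metricSup_nonneg : 0 ≤ metricSup Ω g := ENNReal.toReal_nonneg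

lemma metricL1_nonneg : 0 ≤ metricL1 Ω g := integral_nonneg fun _ => frobNorm_nonneg _

/-- The constant of the Hessian bound divides by this norm. If it vanished, the first diagonal entry
of `g`, at least `c > 0` almost everywhere, would be at most `0` on a set of positive measure. -/
lemma IsTargetMetric.metricSup_pos (hg : IsTargetMetric Ω g) (hΩ : IsOpen Ω) (hne : Ω.Nonempty) :
    0 < metricSup Ω g := by
  refine lt_of_le_of_ne metricSup_nonneg fun h0 => ?_
  obtain ⟨c, hc, hpos⟩ := hg.pos
  have hfalse : ∀ᵐ x ∂(volume.restrict Ω), False := by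
    filter_upwards [hpos, hg.ae_frobNorm_le] with x hx h1
    have h2 := abs_entry_le_frobNorm (g x) 0 0
    have h3 := hx ![1, 0]
    simp [dotProduct, Matrix.mulVec, Fin.sum_univ_two] at h3
    linarith [le_abs_self (g x 0 0)]
  rw [ae_iff] at hfalse
  simp only [not_false_eq_true] at hfalse
  have := hΩ.measure_pos volume hne
  simp at hfalse
  exact this.ne' hfalse

/-- Measurability is read off from `invSqrtFormula`; boundedness follows from `|g^{-1/2}|² = tr g /
det g` and `c² ≤ det g`. -/
lemma IsTargetMetric.memLp_invSqrt (hg : IsTargetMetric Ω g) (a b : Fin 2) :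
    MemLp (fun x => invSqrt (g x) a b) ⊤ (volume.restrict Ω) := by
  obtain ⟨c, hc, hpos⟩ := hg.pos
  have hm : AEMeasurable (fun x => invSqrtFormula (g x) a b) (volume.restrict Ω) := by
    have h00 := hg.aemeasurable 0 0
    have h01 := hg.aemeasurable 0 1
    have h10 := hg.aemeasurable 1 0
    have h11 := hg.aemeasurable 1 1
    have hdet : AEMeasurable (fun x => √(g x).det) (volume.restrict Ω) := by
      simp only [Matrix.det_fin_two]
      exact ((h00.mul h11).sub (h01.mul h10)).sqrt
    have hpre : AEMeasurable (fun x => (√((g x).trace + 2 * √(g x).det) * √(g x).det)⁻¹)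
        (volume.restrict Ω) := by
      refine ((AEMeasurable.sqrt ?_).mul hdet).inv
      simp only [Matrix.trace_fin_two]
      exact (h00.add h11).add (hdet.const_mul 2)
    fin_cases a <;> fin_cases b <;> simp only [invSqrtFormula, Matrix.smul_apply, smul_eq_mul]
    · exact hpre.mul (h11.add hdet)
    · exact hpre.mul h01.neg
    · exact hpre.mul h10.neg
    · exact hpre.mul (h00.add hdet)
  refine memLp_top_of_bound (hm.congr ?_).aestronglyMeasurable
    √(2 * metricSup Ω g / c ^ 2) ?_
  · filter_upwards [hpos, hg.symm] with x h1 h2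
    rw [(invSqrt_facts (g x) h2 hc h1).1]
  · filter_upwards [hpos, hg.symm, hg.ae_frobNorm_le] with x h1 h2 h3
    refine (abs_entry_le_frobNorm _ a b).trans (Real.sqrt_le_sqrt ?_)
    rw [(invSqrt_facts (g x) h2 hc h1).2.1, Matrix.trace_fin_two]
    have hd := sq_le_det (g x) h2 hc h1
    have e0 := (le_abs_self _).trans (abs_entry_le_frobNorm (g x) 0 0)
    have e1 := (le_abs_self _).trans (abs_entry_le_frobNorm (g x) 1 1)
    exact div_le_div₀ (mul_nonneg zero_le_two metricSup_nonneg) (by linarith) (by positivity) hd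

/-- The conjugate `g^{-1/2} A g^{-1/2}`. -/
def conj (g : Plane → Matrix (Fin 2) (Fin 2) ℝ) (A : Plane → Matrix (Fin 2) (Fin 2) ℝ)
    (x : Plane) : Matrix (Fin 2) (Fin 2) ℝ := invSqrt (g x) * A x * invSqrt (g x)

lemma IsTargetMetric.memLp_conj (hg : IsTargetMetric Ω g) {A : Plane → Matrix (Fin 2) (Fin 2) ℝ}
    (hA : ∀ i j, MemLp (fun x => A x i j) ⊤ (volume.restrict Ω)) (i j : Fin 2) :
    MemLp (fun x => conj g A x i j) ⊤ (volume.restrict Ω) :=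
  memLp_top_matrix_mul (memLp_top_matrix_mul hg.memLp_invSqrt hA) hg.memLp_invSqrt i j

lemma IsTargetMetric.ae_frobSq_le (hg : IsTargetMetric Ω g)
    (A : Plane → Matrix (Fin 2) (Fin 2) ℝ) : ∀ᵐ x ∂(volume.restrict Ω),
      frobSq (A x) ≤ metricSup Ω g ^ 2 * frobSq (conj g A x) := by
  obtain ⟨c, hc, hpos⟩ := hg.pos
  filter_upwards [hpos, hg.symm, hg.ae_frobNorm_le] with x h1 h2 h3
  refine ((invSqrt_facts (g x) h2 hc h1).2.2 (A x)).trans ?_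
  refine mul_le_mul_of_nonneg_right ?_ (frobSq_nonneg _)
  rw [← frobNorm_sq]
  exact pow_le_pow_left₀ (frobNorm_nonneg _) h3 2

lemma memLp_trace_sq {A : Plane → Matrix (Fin 2) (Fin 2) ℝ}
    (hA : ∀ i j, MemLp (fun x => A x i j) ⊤ (volume.restrict Ω)) :
    MemLp (fun x => (A x).trace ^ 2) ⊤ (volume.restrict Ω) := by
  simp only [Matrix.trace_fin_two]
  exact memLp_top_pow_two ((hA 0 0).add (hA 1 1))

end Metric

lemma isFiniteMeasure_restrict {Ω : Set Plane} (hΩ : Bornology.IsBounded Ω) :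
    IsFiniteMeasure (volume.restrict Ω) := ⟨by simpa using hΩ.measure_lt_top⟩

/-- The Cauchy–Schwarz inequality against a constant. -/
lemma integral_le_sqrt_mul_sqrt {α : Type*} [MeasurableSpace α] {ν : Measure α} [IsFiniteMeasure ν]
    {f : α → ℝ} (hf : Integrable f ν) (hf2 : Integrable (fun x => f x ^ 2) ν) :
    ∫ x, f x ∂ν ≤ √(ν.real Set.univ) * √(∫ x, f x ^ 2 ∂ν) := by
  set V := ν.real Set.univ with hV
  set m := ∫ x, f x ∂ν with hm
  have hV0 : 0 ≤ V := measureReal_nonneg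
  -- Expanded, this integral is `V * (V * ∫ f² - m²)`; dividing by `V` gives the claim, and `V = 0`
  -- is treated apart.
  have h : 0 ≤ ∫ x, (V * f x - m) ^ 2 ∂ν := integral_nonneg fun _ => sq_nonneg _
  have e : ∫ x, (V * f x - m) ^ 2 ∂ν = V ^ 2 * (∫ x, f x ^ 2 ∂ν) - 2 * V * m * m + V * m ^ 2 := by
    have e1 : ∀ x, (V * f x - m) ^ 2 = V ^ 2 * f x ^ 2 - 2 * V * m * f x + m ^ 2 := fun x => by ring
    simp only [e1]
    have i1 : Integrable (fun x => V ^ 2 * f x ^ 2 - 2 * V * m * f x) ν :=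
      (hf2.const_mul _).sub (hf.const_mul _)
    rw [integral_add i1 (integrable_const _), integral_sub (hf2.const_mul _) (hf.const_mul _), integral_const_mul, integral_const_mul,
      integral_const, smul_eq_mul]
  rw [e] at h
  rw [← Real.sqrt_mul hV0]
  refine Real.le_sqrt_of_sq_le ?_
  rcases hV0.eq_or_lt with h0 | h0
  · have hν : ν = 0 := by
      rw [← Measure.measure_univ_eq_zero]
      exact (ENNReal.toReal_eq_zero_iff _).1 h0.symm |>.resolve_right (measure_ne_top _ _)
    simp [hm, hν]
  · by_contra! hlt
    nlinarith [mul_lt_mul_of_pos_left hlt h0]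

/-! ### The gradient bound -/

section Stretching

variable {Ω : Set Plane} {g : Plane → Matrix (Fin 2) (Fin 2) ℝ} {k : ℕ} {M : IsoMesh k Ω}
  {y : Fin 3 → Plane → ℝ}

/-- The metric deviation `∇yᵀ∇y - g`. -/
def metricDefect (g : Plane → Matrix (Fin 2) (Fin 2) ℝ) (y : Fin 3 → Plane → ℝ) (x : Plane) :
    Matrix (Fin 2) (Fin 2) ℝ := (jac y x).transpose * jac y x - g x

lemma memLp_jac (hy : y ∈ M.deformationSpace) (i : Fin 3) (j : Fin 2) :
    MemLp (fun x => jac y x i j) ⊤ (volume.restrict Ω) :=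
  IsoMesh.memLp_top_of_smoothUpTo fun n => (IsoMesh.smoothUpTo_of_mem_femSpace (hy i) n).grad j

lemma memLp_metricDefect (hg : IsTargetMetric Ω g) (hy : y ∈ M.deformationSpace) (i j : Fin 2) :
    MemLp (fun x => metricDefect g y x i j) ⊤ (volume.restrict Ω) :=
  (memLp_top_matrix_mul (A := fun x => (jac y x).transpose) (fun i j => memLp_jac hy j i)
    (memLp_jac hy) i j).sub (hg.memLp_entry i j)

lemma stretchingEnergy_nonneg {μ lam : ℝ} (hμ : 0 < μ) (hlam : 0 ≤ lam) :
    0 ≤ stretchingEnergy Ω μ lam g y := by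
  refine mul_nonneg (by norm_num) (integral_nonneg fun x => ?_)
  exact add_nonneg (mul_nonneg (by linarith) (frobSq_nonneg _)) (mul_nonneg hlam (sq_nonneg _))

lemma integral_frobSq_le_stretchingEnergy (hΩ : Bornology.IsBounded Ω) (hg : IsTargetMetric Ω g)
    (hy : y ∈ M.deformationSpace) {μ lam : ℝ} (hμ : 0 < μ) (hlam : 0 ≤ lam) :
    ∫ x in Ω, frobSq (conj g (metricDefect g y) x) ≤ 4 / μ * stretchingEnergy Ω μ lam g y := by
  have := isFiniteMeasure_restrict hΩ
  have hA := hg.memLp_conj (memLp_metricDefect hg hy)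
  have h1 := (memLp_top_frobSq hA).integrable le_top
  have h2 := (memLp_trace_sq hA).integrable le_top
  have e : stretchingEnergy Ω μ lam g y = 1 / 8 *
      (2 * μ * (∫ x in Ω, frobSq (conj g (metricDefect g y) x)) +
        lam * ∫ x in Ω, (conj g (metricDefect g y) x).trace ^ 2) := by
    rw [← integral_const_mul, ← integral_const_mul,
      ← integral_add (h1.const_mul _) (h2.const_mul _)]
    rfl
  have h3 : 0 ≤ lam * ∫ x in Ω, (conj g (metricDefect g y) x).trace ^ 2 :=
    mul_nonneg hlam (integral_nonneg fun _ => sq_nonneg _)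
  rw [e, div_mul_eq_mul_div, le_div_iff₀ hμ]
  linarith

/-- The squared gradient is the trace of `∇yᵀ∇y`, and the trace is additive and bounded by a
multiple of the Frobenius norm. Thus the defect enters linearly, which explains the square root of
the energy in the gradient bound. -/
lemma frobSq_jac_le (x : Plane) :
    frobSq (jac y x) ≤ 2 * frobNorm (metricDefect g y x) + 2 * frobNorm (g x) := by
  have htr : ∀ A : Matrix (Fin 2) (Fin 2) ℝ, A.trace ≤ 2 * frobNorm A := fun A => by
    refine le_of_abs_le (abs_le_of_sq_le_sq ?_ (mul_nonneg zero_le_two (frobNorm_nonneg _)))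
    have := frobSq_nonneg A
    rw [mul_pow, frobNorm_sq]
    linarith [trace_sq_le A]
  have e : frobSq (jac y x) = (metricDefect g y x).trace + (g x).trace := by
    rw [← trace_transpose_mul_self, ← Matrix.trace_add, metricDefect, sub_add_cancel]
  rw [e]
  exact add_le_add (htr _) (htr _)

/-- Integrate `frobSq_jac_le`, remove the conjugation from the defect, and apply Cauchy–Schwarz
against `1`. The shear part of the energy carries the weight `μ / 4`, whence `2 / √μ`. -/
theorem gradNormSq_le (hΩ : Bornology.IsBounded Ω) (hg : IsTargetMetric Ω g)
    (hy : y ∈ M.deformationSpace) {μ lam : ℝ} (hμ : 0 < μ) (hlam : 0 ≤ lam) :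
    gradNormSq Ω y ≤ (2 + 4 / √μ) *
      (√(volume.real Ω) * metricSup Ω g * √(stretchingEnergy Ω μ lam g y) + metricL1 Ω g) := by
  have := isFiniteMeasure_restrict hΩ
  have hA := memLp_metricDefect hg hy
  have hB := hg.memLp_conj hA
  have hAi := (memLp_frobNorm hA).integrable le_top
  have hBi := (memLp_frobNorm hB).integrable le_top
  have hB2 := (memLp_top_pow_two (memLp_frobNorm hB)).integrable le_top
  have hgi := (memLp_frobNorm hg.memLp_entry).integrable le_top
  set s := metricSup Ω g with hs
  have hs0 : 0 ≤ s := metricSup_nonneg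
  set E := stretchingEnergy Ω μ lam g y with hE
  have h1 : gradNormSq Ω y ≤ 2 * (∫ x in Ω, frobNorm (metricDefect g y x)) + 2 * metricL1 Ω g := by
    rw [metricL1, ← integral_const_mul, ← integral_const_mul,
      ← integral_add (hAi.const_mul _) (hgi.const_mul _)]
    exact integral_mono ((memLp_top_frobSq (memLp_jac hy)).integrable le_top)
      ((hAi.const_mul _).add (hgi.const_mul _)) frobSq_jac_le
  have h2 : ∫ x in Ω, frobNorm (metricDefect g y x) ≤
      s * ∫ x in Ω, frobNorm (conj g (metricDefect g y) x) := by
    rw [← integral_const_mul]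
    refine integral_mono_ae hAi (hBi.const_mul _) ?_
    filter_upwards [hg.ae_frobSq_le (metricDefect g y)] with x hx
    refine (Real.sqrt_le_sqrt hx).trans (le_of_eq ?_)
    rw [Real.sqrt_mul (sq_nonneg _), Real.sqrt_sq hs0]
    rfl
  have h3 : ∫ x in Ω, frobNorm (conj g (metricDefect g y) x) ≤
      √(volume.real Ω) * (2 / √μ * √E) := by
    refine (integral_le_sqrt_mul_sqrt hBi hB2).trans ?_
    rw [measureReal_restrict_apply_univ]
    refine mul_le_mul_of_nonneg_left ?_ (Real.sqrt_nonneg _)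
    simp only [frobNorm_sq]
    refine (Real.sqrt_le_sqrt (integral_frobSq_le_stretchingEnergy hΩ hg hy hμ hlam)).trans
      (le_of_eq ?_)
    rw [Real.sqrt_mul (by positivity), Real.sqrt_div (by norm_num),
      (by norm_num : (4 : ℝ) = 2 ^ 2), Real.sqrt_sq zero_le_two]
  have h4 : ∫ x in Ω, frobNorm (metricDefect g y x) ≤ s * (√(volume.real Ω) * (2 / √μ * √E)) :=
    h2.trans (mul_le_mul_of_nonneg_left h3 hs0)
  have hL := metricL1_nonneg (Ω := Ω) (g := g)
  have h5 : 0 ≤ √(volume.real Ω) * s * √E := by positivity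
  have h6 : 0 ≤ 4 / √μ * metricL1 Ω g := by positivity
  have e : s * (√(volume.real Ω) * (2 / √μ * √E)) =
      2 / √μ * (√(volume.real Ω) * s * √E) := by ring
  rw [e] at h4
  have e2 : 4 / √μ = 2 * (2 / √μ) := by ring
  rw [e2] at h6 ⊢
  nlinarith

end Stretching

/-! ### The discrete Hessian bound -/

section Bending

variable {Ω : Set Plane} {g : Plane → Matrix (Fin 2) (Fin 2) ℝ} {k : ℕ} {M : IsoMesh k Ω}
  {y : Fin 3 → Plane → ℝ}

lemma memLp_discreteHessian (crease : Set Plane) (l : ℕ) {v : Plane → ℝ} (hv : v ∈ M.femSpace)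
    (a b : Fin 2) :
    MemLp (fun x => M.discreteHessian crease l v x a b) ⊤ (volume.restrict Ω) := by
  simp only [IsoMesh.discreteHessian, Matrix.sub_apply, Matrix.sum_apply]
  exact (IsoMesh.memLp_brokenHessian hv a b).sub
    (memLp_finsetSum _ fun e _ => IsoMesh.memLp_localLifting l e _ a b)

lemma bendingEnergy_nonneg (crease : Set Plane) (l : ℕ) {μ lam γ : ℝ} (hμ : 0 < μ)
    (hlam : 0 ≤ lam) (hγ : 0 < γ) : 0 ≤ M.bendingEnergy crease l μ lam γ g y := by
  refine add_nonneg (mul_nonneg (by norm_num) (integral_nonneg fun x => ?_))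
    (mul_nonneg (by linarith) (Finset.sum_nonneg fun m _ => M.jumpNormSq_nonneg crease _))
  exact add_nonneg (mul_nonneg (by linarith) (Finset.sum_nonneg fun _ _ => frobSq_nonneg _))
    (mul_nonneg (by positivity) (Finset.sum_nonneg fun _ _ => sq_nonneg _))

lemma le_bendingEnergy (hΩ : Bornology.IsBounded Ω) (hg : IsTargetMetric Ω g)
    (hy : y ∈ M.deformationSpace) (crease : Set Plane) (l : ℕ) {μ lam γ : ℝ} (hμ : 0 < μ)
    (hlam : 0 ≤ lam) :
    μ / 12 * (∑ m, ∫ x in Ω, frobSq (conj g (M.discreteHessian crease l (y m)) x)) +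
      γ / 2 * ∑ m, M.jumpNormSq crease (y m) ≤ M.bendingEnergy crease l μ lam γ g y := by
  have := isFiniteMeasure_restrict hΩ
  have hA := fun m => hg.memLp_conj (memLp_discreteHessian crease l (hy m))
  have h1 := fun m => (memLp_top_frobSq (hA m)).integrable le_top
  have h2 := fun m => (memLp_trace_sq (hA m)).integrable le_top
  have e : M.bendingEnergy crease l μ lam γ g y = 1 / 24 *
      (2 * μ * (∑ m, ∫ x in Ω, frobSq (conj g (M.discreteHessian crease l (y m)) x)) +
        2 * μ * lam / (2 * μ + lam) *
          ∑ m, ∫ x in Ω, (conj g (M.discreteHessian crease l (y m)) x).trace ^ 2) +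
      γ / 2 * ∑ m, M.jumpNormSq crease (y m) := by
    rw [← integral_finsetSum _ fun m _ => h1 m, ← integral_finsetSum _ fun m _ => h2 m,
      ← integral_const_mul, ← integral_const_mul,
      ← integral_add ((integrable_finsetSum _ fun m _ => h1 m).const_mul _)
        ((integrable_finsetSum _ fun m _ => h2 m).const_mul _)]
    rfl
  have h3 : 0 ≤ 2 * μ * lam / (2 * μ + lam) *
      ∑ m, ∫ x in Ω, (conj g (M.discreteHessian crease l (y m)) x).trace ^ 2 :=
    mul_nonneg (by positivity)
      (Finset.sum_nonneg fun _ _ => integral_nonneg fun _ => sq_nonneg _)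
  rw [e]
  linarith

/-- The broken Hessian is the discrete Hessian plus the sum of the liftings; the hypothesis `hK`
trades the latter for jumps. -/
lemma seminormSq_le (hΩ : Bornology.IsBounded Ω) (hg : IsTargetMetric Ω g) (crease : Set Plane)
    (l : ℕ) {v : Plane → ℝ} (hv : v ∈ M.femSpace) {K : ℝ}
    (hK : ∫ x in Ω, frobSq (∑ e ∈ M.freeEdges crease, M.localLifting l e (M.jumpGrad e v) x) ≤
      K * M.jumpNormSq crease v) :
    M.seminormSq crease v ≤
      2 * metricSup Ω g ^ 2 * (∫ x in Ω, frobSq (conj g (M.discreteHessian crease l v) x)) +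
        (2 * K + 1) * M.jumpNormSq crease v := by
  have := isFiniteMeasure_restrict hΩ
  have hH := memLp_discreteHessian crease l hv
  have hHi := (memLp_top_frobSq hH).integrable le_top
  have hCi := (memLp_top_frobSq (hg.memLp_conj hH)).integrable le_top
  set R := fun x => ∑ e ∈ M.freeEdges crease, M.localLifting l e (M.jumpGrad e v) x with hR
  have hRi : Integrable (fun x => frobSq (R x)) (volume.restrict Ω) := by
    refine (memLp_top_frobSq fun a b => ?_).integrable le_top
    simp only [hR, Matrix.sum_apply]
    exact memLp_finsetSum _ fun e _ => IsoMesh.memLp_localLifting l e _ a b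
  have h1 : ∫ x in Ω, frobSq (brokenHessian v x) ≤
      2 * (∫ x in Ω, frobSq (M.discreteHessian crease l v x)) + 2 * ∫ x in Ω, frobSq (R x) := by
    rw [← integral_const_mul, ← integral_const_mul,
      ← integral_add (hHi.const_mul _) (hRi.const_mul _)]
    refine integral_mono ((memLp_top_frobSq
      (IsoMesh.memLp_brokenHessian hv)).integrable le_top)
      ((hHi.const_mul _).add (hRi.const_mul _)) fun x => ?_
    have e : brokenHessian v x = M.discreteHessian crease l v x + R x := by
      rw [IsoMesh.discreteHessian, sub_add_cancel]
    conv_lhs => rw [e]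
    exact frobSq_add_le _ _
  have h2 : ∫ x in Ω, frobSq (M.discreteHessian crease l v x) ≤
      metricSup Ω g ^ 2 * ∫ x in Ω, frobSq (conj g (M.discreteHessian crease l v) x) := by
    rw [← integral_const_mul]
    exact integral_mono_ae hHi (hCi.const_mul _) (hg.ae_frobSq_le _)
  rw [IsoMesh.seminormSq]
  linarith

/-- An interior edge would have its midpoint image inside the empty set. -/
lemma deformationSeminormSq_empty {k : ℕ} (M : IsoMesh k ∅) (crease : Set Plane)
    (y : Fin 3 → Plane → ℝ) : M.deformationSeminormSq crease y = 0 := by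
  have h : M.freeEdges crease = ∅ := by
    refine Finset.eq_empty_of_forall_notMem fun e he => ?_
    have h1 := (IsoMesh.mem_interiorEdges.1 (IsoMesh.freeEdges_subset crease he)).2.2.2
    exact h1 (Set.mem_image_of_mem _ (midpoint_mem_openSegment _ _))
  simp [IsoMesh.deformationSeminormSq, IsoMesh.seminormSq, IsoMesh.jumpNormSq, h]

lemma exists_regular {ι : Type} {M : ι → IsoMesh k Ω} (hs : ShapeRegular M)
    (hq : QuasiUniform M) : ∃ σ τ : ℝ, 1 ≤ σ ∧ 1 ≤ τ ∧ ∀ h, (M h).Regular σ τ := by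
  obtain ⟨σ, hσ⟩ := hs
  obtain ⟨τ, hτ⟩ := hq
  refine ⟨max σ 1, max τ 1, le_max_right _ _, le_max_right _ _, fun h =>
    ⟨le_max_right _ _, le_max_right _ _, fun i z hz => ?_, fun i j => ?_⟩⟩
  · have hd := ((M h).elem i).diam_pos
    exact ⟨(hσ h i z hz).1.trans (mul_le_mul_of_nonneg_right (le_max_left _ _) hd.le),
      (hσ h i z hz).2.trans (mul_le_mul_of_nonneg_right (le_max_left _ _) (inv_pos.2 hd).le)⟩
  · exact (hτ h i j).trans
      (mul_le_mul_of_nonneg_right (le_max_left _ _) ((M h).elem j).diam_pos.le)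

theorem exists_bending_coercivity (hΩo : IsOpen Ω) (hΩ : Bornology.IsBounded Ω)
    (hg : IsTargetMetric Ω g) (crease : Set Plane) {μ lam : ℝ} (hμ : 0 < μ) (hlam : 0 ≤ lam)
    (l : ℕ) {ι : Type} {M : ι → IsoMesh k Ω} (hs : ShapeRegular M) (hq : QuasiUniform M) :
    ∃ C : ℝ → ℝ, (∀ γ, 0 < γ → 0 < C γ) ∧ Tendsto C (𝓝[>] 0) atTop ∧
      ∀ γ : ℝ, 0 < γ → ∀ h, ∀ y ∈ (M h).deformationSpace,
        (M h).deformationSeminormSq crease y ≤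
          C γ * (metricSup Ω g * (M h).bendingEnergy crease l μ lam γ g y) := by
  -- On the empty set `‖g‖_∞` vanishes and cannot be divided by. The seminorm vanishes too, so any
  -- positive function that blows up at `0` will do.
  rcases Ω.eq_empty_or_nonempty with rfl | hne
  · refine ⟨fun γ => γ⁻¹, fun γ hγ => inv_pos.2 hγ, tendsto_inv_nhdsGT_zero,
      fun γ hγ h y _ => ?_⟩
    rw [deformationSeminormSq_empty]
    exact mul_nonneg (inv_pos.2 hγ).le
      (mul_nonneg metricSup_nonneg (bendingEnergy_nonneg crease l hμ hlam hγ))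
  obtain ⟨σ, τ, hσ, hτ, hreg⟩ := exists_regular hs hq
  obtain ⟨K, hK0, hK⟩ := IsoMesh.exists_lifting_stability l σ τ hσ hτ
  have hG := hg.metricSup_pos hΩo hne
  set G := metricSup Ω g with hGdef
  -- The bounds `X ≤ (12 / μ) E` and `J ≤ (2 / γ) E` are inserted into `2 G² X + (2 K + 1) J`, and
  -- one factor `G` is taken out. The jump term supplies the blow-up.
  refine ⟨fun γ => 24 * G / μ + 2 * (2 * K + 1) / G * γ⁻¹, fun γ hγ => by positivity,
    tendsto_atTop_add_const_left _ _
      (tendsto_inv_nhdsGT_zero.const_mul_atTop (by positivity)), fun γ hγ h y hy => ?_⟩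
  set X := ∑ m, ∫ x in Ω, frobSq (conj g ((M h).discreteHessian crease l (y m)) x) with hX
  set J := ∑ m, (M h).jumpNormSq crease (y m) with hJ
  have hX0 : 0 ≤ X := Finset.sum_nonneg fun _ _ => integral_nonneg fun _ => frobSq_nonneg _
  have hJ0 : 0 ≤ J := Finset.sum_nonneg fun _ _ => (M h).jumpNormSq_nonneg crease _
  have hE := le_bendingEnergy hΩ hg hy crease l (γ := γ) hμ hlam
  rw [← hX, ← hJ] at hE
  set E := (M h).bendingEnergy crease l μ lam γ g y with hEdef
  have hsemi : (M h).deformationSeminormSq crease y ≤ 2 * G ^ 2 * X + (2 * K + 1) * J := by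
    rw [IsoMesh.deformationSeminormSq, hX, hJ, Finset.mul_sum, Finset.mul_sum,
      ← Finset.sum_add_distrib]
    exact Finset.sum_le_sum fun m _ => seminormSq_le hΩ hg crease l (hy m)
      (hK (M h) hΩ (hreg h) crease (y m) (hy m))
  have hXE : X ≤ 12 / μ * E := by
    rw [div_mul_eq_mul_div, le_div_iff₀ hμ]
    nlinarith [mul_nonneg hγ.le hJ0]
  have hJE : J ≤ 2 * γ⁻¹ * E := by
    rw [← div_eq_mul_inv, div_mul_eq_mul_div, le_div_iff₀ hγ]
    nlinarith [mul_nonneg hμ.le hX0]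
  refine hsemi.trans ((add_le_add (mul_le_mul_of_nonneg_left hXE (by positivity))
    (mul_le_mul_of_nonneg_left hJE (by positivity))).trans (le_of_eq ?_))
  field_simp
  ring

end Bending

end PrestrainedPlate

end

/-! ### Assembly of the three bounds -/

theorem mainTheorem7 :
    -- the gradient bound; the constant depends only on `μ`
    (∀ μ : ℝ, 0 < μ → ∃ C : ℝ, 0 < C ∧
      ∀ lam : ℝ, 0 ≤ lam →
      ∀ Ω : Set Plane, IsOpen Ω → Bornology.IsBounded Ω →
      ∀ g : Plane → Matrix (Fin 2) (Fin 2) ℝ, IsTargetMetric Ω g →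
      ∀ k : ℕ, 2 ≤ k → ∀ M : IsoMesh k Ω, ∀ y ∈ M.deformationSpace,
        gradNormSq Ω y ≤
          C * (√(volume.real Ω) * metricSup Ω g * √(stretchingEnergy Ω μ lam g y) +
            metricL1 Ω g)) ∧
    -- the discrete second-order bound; the constant does not depend on the mesh
    (∀ Ω : Set Plane, IsOpen Ω → Bornology.IsBounded Ω →
      ∀ g : Plane → Matrix (Fin 2) (Fin 2) ℝ, IsTargetMetric Ω g →
      ∀ crease : Set Plane, crease ⊆ Ω →
      ∀ μ lam : ℝ, 0 < μ → 0 ≤ lam →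
      ∀ k l : ℕ, 2 ≤ k →
      ∀ (ι : Type) (M : ι → IsoMesh k Ω), ShapeRegular M → QuasiUniform M →
        (∀ h, (M h).Resolves crease) →
      ∃ C : ℝ → ℝ, (∀ γ, 0 < γ → 0 < C γ) ∧ Tendsto C (𝓝[>] 0) atTop ∧
        ∀ γ : ℝ, 0 < γ → ∀ h, ∀ y ∈ (M h).deformationSpace,
          (M h).deformationSeminormSq crease y ≤
            C γ * (metricSup Ω g * (M h).bendingEnergy crease l μ lam γ g y)) ∧
    -- the combined bound; the additive constant `C` depends only on `Ω` and `g`, and the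
    -- multiplicative constant `K` does not depend on the mesh or on the thickness `θ`
    (∀ Ω : Set Plane, IsOpen Ω → Bornology.IsBounded Ω →
      ∀ g : Plane → Matrix (Fin 2) (Fin 2) ℝ, IsTargetMetric Ω g →
      ∃ C : ℝ, 0 ≤ C ∧
        ∀ crease : Set Plane, crease ⊆ Ω →
        ∀ μ lam γ : ℝ, 0 < μ → 0 ≤ lam → 0 < γ →
        ∀ k l : ℕ, 2 ≤ k →
        ∀ (ι : Type) (M : ι → IsoMesh k Ω), ShapeRegular M → QuasiUniform M →
          (∀ h, (M h).Resolves crease) →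
        ∃ K : ℝ, 0 < K ∧
          ∀ θ : ℝ, 0 < θ → ∀ h, ∀ y ∈ (M h).deformationSpace,
            gradNormSq Ω y ^ 2 + θ ^ 2 * (M h).deformationSeminormSq crease y ≤
              K * ((M h).energy crease l μ lam γ θ g y + C)) := by
  refine ⟨fun μ hμ => ⟨2 + 4 / √μ, by positivity, fun lam hlam Ω _ hΩ g hg k _ M y hy =>
      gradNormSq_le hΩ hg hy hμ hlam⟩,
    fun Ω hΩo hΩ g hg crease _ μ lam hμ hlam k l _ ι M hs hq _ =>
      exists_bending_coercivity hΩo hΩ hg crease hμ hlam l hs hq,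
    -- The additive constant is what the term `‖g‖_{L¹}` of the gradient bound leaves after
    -- squaring.
    fun Ω hΩo hΩ g hg => ⟨metricL1 Ω g ^ 2, sq_nonneg _,
      fun crease _ μ lam γ hμ hlam hγ k l _ ι M hs hq _ => ?_⟩⟩
  obtain ⟨C₂, hC₂, -, hsemi⟩ :=
    exists_bending_coercivity hΩo hΩ hg crease hμ hlam l hs hq
  have hc := hC₂ γ hγ
  set G := metricSup Ω g with hG
  have hG0 : 0 ≤ G := metricSup_nonneg
  set C₁ := 2 + 4 / √μ with hC₁
  have hC₁0 : 0 < C₁ := by positivity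
  set V := volume.real Ω with hV
  have hV0 : 0 ≤ V := measureReal_nonneg
  -- The sum of the coefficients of the stretching energy, of `‖g‖_{L¹}²` and of the bending energy;
  -- it dominates each of them since all three quantities are nonnegative.
  refine ⟨2 * C₁ ^ 2 * (V * G ^ 2) + 2 * C₁ ^ 2 + C₂ γ * G, by positivity,
    fun θ hθ h y hy => ?_⟩
  set L := metricL1 Ω g with hL
  have hgrad := gradNormSq_le hΩ hg hy hμ hlam
  have hgrad0 : 0 ≤ gradNormSq Ω y := integral_nonneg fun _ => frobSq_nonneg _
  have hbend := mul_le_mul_of_nonneg_left (hsemi γ hγ h y hy) (sq_nonneg θ)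
  have hES := stretchingEnergy_nonneg (Ω := Ω) (g := g) (y := y) hμ hlam
  have hEB := bendingEnergy_nonneg (M := M h) (g := g) (y := y) crease l hμ hlam hγ
  rw [IsoMesh.energy]
  set ES := stretchingEnergy Ω μ lam g y
  set EB := θ ^ 2 * (M h).bendingEnergy crease l μ lam γ g y with hEBdef
  have hEB0 : 0 ≤ EB := mul_nonneg (sq_nonneg θ) hEB
  have hsq : gradNormSq Ω y ^ 2 ≤ 2 * C₁ ^ 2 * (V * G ^ 2) * ES + 2 * C₁ ^ 2 * L ^ 2 := by
    refine (pow_le_pow_left₀ hgrad0 hgrad 2).trans ?_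
    have h1 : (√V * G * √ES) ^ 2 = V * G ^ 2 * ES := by
      rw [mul_pow, mul_pow, Real.sq_sqrt hV0, Real.sq_sqrt hES]
    have h2 : (√V * G * √ES + L) ^ 2 ≤ 2 * (V * G ^ 2 * ES) + 2 * L ^ 2 := by
      rw [← h1]; nlinarith [sq_nonneg (√V * G * √ES - L)]
    rw [mul_pow]
    nlinarith [mul_le_mul_of_nonneg_left h2 (sq_nonneg C₁)]
  have hbend' : θ ^ 2 * (M h).deformationSeminormSq crease y ≤ C₂ γ * G * EB := by
    refine hbend.trans (le_of_eq ?_)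
    rw [hEBdef]; ring
  have p1 : 0 ≤ 2 * C₁ ^ 2 * (V * G ^ 2) := by positivity
  have p2 : 0 ≤ 2 * C₁ ^ 2 := by positivity
  have p3 : 0 ≤ C₂ γ * G := by positivity
  nlinarith [mul_nonneg p1 hEB0, mul_nonneg p1 (sq_nonneg L), mul_nonneg p2 hES,
    mul_nonneg p2 hEB0, mul_nonneg p3 hES, mul_nonneg p3 (sq_nonneg L)]
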